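/- Let $d\ge 1$, $r_1\ge 1$, $r_2\ge 0$ be integers and $r:=r_1+r_2$. Let $p_X,p_Y$ be probability densities on $\mathbb R^d$ that are bounded and continuous except at finitely many (possibly zero) points. Let $X,X_1,X_2,\dots$ have density $p_X$ and $Y,Y_1,Y_2,\dots$ have density $p_Y$, with $X_1,X_2,\dots,Y_1,Y_2,\dots$ mutually independent. Consider sample sizes $\mathbf n=(n_1,n_2)$ with $n_1,n_2\to\infty$, put $n:=n_1+n_2$ and assume $n_1/n\to p\in(0,1)$; let $\epsilon=\epsilon(\mathbf n)>0$ with $\epsilon\to 0$. Let $B_\epsilon(x)$ be the closed Euclidean ball with centre $x$ and radius $\epsilon$, and $b_\epsilon$ its Lebesgue measure. Define $$q_{\mathbf r}:=\int_{\mathbb R^d}p_X^{r_1}p_Y^{r_2}\,dx,\qquad \tilde q_{\mathbf r,\epsilon}:=b_\epsilon^{-(r-1)}\,\mathrm E\big[p_{X,\epsilon}(X)^{r_1-1}p_{Y,\epsilon}(X)^{r_2}\big],$$ where $p_{X,\epsilon}(x):=P(X\in B_\epsilon(x))$ and $p_{Y,\epsilon}(x):=P(Y\in B_\epsilon(x))$,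 and $$\tilde Q_{\mathbf n}:=b_\epsilon^{-(r-1)}\binom{n_1}{r_1}^{-1}\binom{n_2}{r_2}^{-1}\sum_{S}\sum_{T}\frac1{r_1}\sum_{i\in S}\mathbf 1\{|X_i-X_j|\le\epsilon,\ |X_i-Y_k|\le\epsilon\ \ \forall j\in S,\ \forall k\in T\},$$ where $S$ runs over the $r_1$-element subsets of $\{1,\dots,n_1\}$ and $T$ over the $r_2$-element subsets of $\{1,\dots,n_2\}$. (Thus $\tilde q_{\mathbf r,\epsilon}=\mathrm E\,\tilde Q_{\mathbf n}$ as soon as $n_1\ge r_1$ and $n_2\ge r_2$.) Let $$\zeta_{1,0}:=\mathrm{Var}\big(p_X(X)^{r_1-1}p_Y(X)^{r_2}\big),\quad \zeta_{0,1}:=\mathrm{Var}\big(p_X(Y)^{r_1}p_Y(Y)^{r_2-1}\big),\quad \kappa:=\frac{r_1^2\zeta_{1,0}}{p}+\frac{r_2^2\zeta_{0,1}}{1-p},$$ where for $r_2=0$ the second term of $\kappa$ is absent. Then, as $\mathbf n\to\infty$: (i) $\mathrm E\,\tilde Q_{\mathbf n}\to q_{\mathbf r}$. If $n\epsilon^{d(1-1/r)}$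 stays bounded away from $0$, then $\mathrm{Var}(\tilde Q_{\mathbf n})=O\big(n^{-1}\epsilon^{d(1/r-1)}\big)$. Hence, if $n\epsilon^{d(1-1/r)}\to\infty$, then $\tilde Q_{\mathbf n}$ is a consistent estimator of $q_{\mathbf r}$, that is, $\tilde Q_{\mathbf n}\to q_{\mathbf r}$ in probability. (ii) If $n\epsilon^d\to\infty$, $\zeta_{1,0}>0$ and (when $r_2\ge1$) $\zeta_{0,1}>0$, then $\sqrt n\,(\tilde Q_{\mathbf n}-\tilde q_{\mathbf r,\epsilon})\to N(0,\kappa)$ in distribution. -/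

import Mathlib

open MeasureTheory ProbabilityTheory Filter Topology Asymptotics

namespace RenyiStat

noncomputable section

/-- The space `ℝ^d` with the Euclidean distance. -/
abbrev Sp (d : ℕ) : Type := EuclideanSpace ℝ (Fin d)

/-- The distribution on `ℝ^d` with Lebesgue density `p`. -/
def law {d : ℕ} (p : Sp d → ℝ) : Measure (Sp d) :=
  (volume : Measure (Sp d)).withDensity (fun x => ENNReal.ofReal (p x))

/-- `b_ε(d)`: the volume of a Euclidean ball of radius `ε` in `ℝ^d`. -/
def ballVol (d : ℕ) (ε : ℝ) : ℝ :=
  (volume : Measure (Sp d)).real (Metric.closedBall (0 : Sp d) ε)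

/-- `p_{X,ε}(x) = P(X ∈ B_ε(x))`, where `P` is the distribution of `X`. -/
def ballProb {d : ℕ} (P : Measure (Sp d)) (ε : ℝ) (x : Sp d) : ℝ :=
  P.real (Metric.closedBall x ε)

/-- The entropy functional `q_r = ∫ p_X(x)^{r₁} p_Y(x)^{r₂} dx`. -/
def q {d : ℕ} (r₁ r₂ : ℕ) (pX pY : Sp d → ℝ) : ℝ :=
  ∫ x, pX x ^ r₁ * pY x ^ r₂

/-- The `ε`-coincidence probability `q_{r,ε} = E p_{X,ε}(X)^{r₁-1} p_{Y,ε}(X)^{r₂}` (for `r₁ ≥ 1`),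
where `X` has density `pX`. -/
def qEps {d : ℕ} (r₁ r₂ : ℕ) (pX pY : Sp d → ℝ) (ε : ℝ) : ℝ :=
  ∫ x, ballProb (law pX) ε x ^ (r₁ - 1) * ballProb (law pY) ε x ^ r₂ ∂(law pX)

/-- `q̃_{r,ε} = q_{r,ε} / b_ε(d)^{r-1}`, with `r = r₁ + r₂ ≥ 1`. -/
def qTilde {d : ℕ} (r₁ r₂ : ℕ) (pX pY : Sp d → ℝ) (ε : ℝ) : ℝ :=
  qEps r₁ r₂ pX pY ε / ballVol d ε ^ (r₁ + r₂ - 1)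

open Classical in
/-- `ψ^{(i)}(S;T)`: the indicator that all `x_j`, `j ∈ S`, and all `y_k`, `k ∈ T`, are
`ε`-close to `x_i`. -/
def psiAt {d : ℕ} (ε : ℝ) (x y : ℕ → Sp d) (S T : Finset ℕ) (i : ℕ) : ℝ :=
  if (∀ j ∈ S, dist (x i) (x j) ≤ ε) ∧ (∀ k ∈ T, dist (x i) (y k) ≤ ε) then 1 else 0

/-- The symmetrized kernel `ψ(S;T) = r₁⁻¹ ∑_{i ∈ S} ψ^{(i)}(S;T)`, where `r₁ = |S|`. -/
def psi {d : ℕ} (ε : ℝ) (x y : ℕ → Sp d) (S T : Finset ℕ) : ℝ :=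
  (S.card : ℝ)⁻¹ * ∑ i ∈ S, psiAt ε x y S T i

/-- The generalized `U`-statistic `Q_n`, `n = (n₁, n₂)`, evaluated at the samples
`x_0, …, x_{n₁-1}` and `y_0, …, y_{n₂-1}`. -/
def U {d : ℕ} (r₁ r₂ n₁ n₂ : ℕ) (ε : ℝ) (x y : ℕ → Sp d) : ℝ :=
  (n₁.choose r₁ : ℝ)⁻¹ * (n₂.choose r₂ : ℝ)⁻¹ *
    ∑ S ∈ (Finset.range n₁).powersetCard r₁, ∑ T ∈ (Finset.range n₂).powersetCard r₂,
      psi ε x y S T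

/-- The estimator `Q̃_n = Q_n / b_ε(d)^{r-1}`, with `r = r₁ + r₂ ≥ 1`. -/
def UTilde {d : ℕ} (r₁ r₂ n₁ n₂ : ℕ) (ε : ℝ) (x y : ℕ → Sp d) : ℝ :=
  U r₁ r₂ n₁ n₂ ε x y / ballVol d ε ^ (r₁ + r₂ - 1)

/-- `ζ_{1,0} = Var(p_X(X)^{r₁-1} p_Y(X)^{r₂})`, where `X` has density `pX`. -/
def zeta10 {d : ℕ} (r₁ r₂ : ℕ) (pX pY : Sp d → ℝ) : ℝ :=
  Var[fun x => pX x ^ ((r₁ : ℤ) - 1) * pY x ^ r₂; law pX]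

/-- `ζ_{0,1} = Var(p_X(Y)^{r₁} p_Y(Y)^{r₂-1})`, where `Y` has density `pY`. -/
def zeta01 {d : ℕ} (r₁ r₂ : ℕ) (pX pY : Sp d → ℝ) : ℝ :=
  Var[fun y => pX y ^ r₁ * pY y ^ ((r₂ : ℤ) - 1); law pY]

/-- `κ = p⁻¹ r₁² ζ_{1,0} + (1-p)⁻¹ r₂² ζ_{0,1}`; the second term is absent when `r₂ = 0`. -/
def kappa {d : ℕ} (r₁ r₂ : ℕ) (pX pY : Sp d → ℝ) (p : ℝ) : ℝ :=
  p⁻¹ * (r₁ : ℝ) ^ 2 * zeta10 r₁ r₂ pX pY + (1 - p)⁻¹ * (r₂ : ℝ) ^ 2 * zeta01 r₁ r₂ pX pY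

end

end RenyiStat

/-!
The estimator `Q̃` is a two-sample `U`-statistic with a kernel that depends on `ε`. Both samples are
treated as one family of independent points indexed by `ℕ ⊕ ℕ`, so that `Q̃` is an average of
kernels `normKernel ε A` over index sets `A` made of `r₁` points of the first and `r₂` points of the
second sample (`UTilde_eq_average`).

*Second moments.* Two kernels on `A` and `B` are independent if `A ∩ B = ∅`. If `|A ∩ B| = m ≥ 1`,
their product is nonzero only when all the points with indices in `A ∪ B` lie within `2ε` of a
common one, so its mean is `O(b_ε^{-(m-1)})` (`integral_normKernel_mul_le`). The proportion of `B`
with `|A ∩ B| ≥ m` is `O(n^{-m})` (`card_samplePairs_filter_le`). Hence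
`Var Q̃ = O(∑_{1 ≤ m ≤ r} n^{-m} ε^{-d(m-1)})` (`integral_sq_average_le`), and every summand is
`O(n^{-1} ε^{d(1/r-1)})` if `n ε^{d(1-1/r)}` is bounded below (`overlap_term_le`). The bias
vanishes because averages of a density over shrinking balls converge at its continuity points
(`tendsto_qTilde`). Together these give consistency.

*Asymptotic normality.* Let `h = pX^{r₁-1} pY^{r₂}` and `g = pX^{r₁} pY^{r₂-1}` be the limits of the
conditional means of the kernel given one point of the first or second sample. From each kernel,
subtract its mean and the sum of the centred values of `h` and `g` at its points. The averages of
these residuals over `A` are exactly `Q̃ - q̃` minus the linear statistic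
`(r₁/n₁) ∑ (h(X_i) - q) + (r₂/n₂) ∑ (g(Y_k) - q)`. Residuals with a one-point overlap `{c}` are
conditionally independent given the point `c`, so their mixed moment is the mean square of the
difference between the conditional mean and its limit, which tends to zero by bounded convergence
(`integral_residual_mul_of_inter_eq_singleton`). The overlaps `m ≥ 2` contribute
`O(n^{-1} (n ε^d)^{-(m-1)})`. So for `n ε^d → ∞` the mean square of the linearization error is
`o(1/n)` (`tendsto_mul_integral_sq_linearization`), and the one-dimensional central limit theorem,
applied to the two independent sums, gives the limit `N(0, κ)`.
-/

namespace RenyiStat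

/-! ### Functions of independent coordinates -/

section Independence

variable {Ω ι E : Type*} [MeasurableSpace Ω] [MeasurableSpace E] [DecidableEq ι]
  {μ : Measure Ω} {Z : ι → Ω → E}

/-- Extension of finitely many coordinates by an arbitrary value. -/
noncomputable def extendArbitrary [Nonempty E] (A : Finset ι) (w : A → E) : ι → E :=
  fun i => if h : i ∈ A then w ⟨i, h⟩ else Classical.arbitrary E

lemma measurable_extendArbitrary [Nonempty E] (A : Finset ι) :
    Measurable (extendArbitrary (E := E) A) := by
  refine measurable_pi_lambda _ fun i => ?_
  by_cases h : i ∈ A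
  · simpa [extendArbitrary, h] using measurable_pi_apply _
  · simp [extendArbitrary, h]

/-- A measurable function of finitely many coordinates factors measurably through their
restriction. -/
lemma exists_measurable_factor {β : Type*} [MeasurableSpace β] [Nonempty E]
    {F : (ι → E) → β} (hF : Measurable F) (A : Finset ι) (hFA : DependsOn F (A : Set ι)) :
    ∃ G : (A → E) → β, Measurable G ∧ ∀ z, F z = G (fun i => z i) := by
  refine ⟨fun w => F (extendArbitrary A w), hF.comp (measurable_extendArbitrary A),
    fun z => hFA fun i hi => ?_⟩
  simp [extendArbitrary, Finset.mem_coe.1 hi]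

lemma indepFun_of_dependsOn [IsProbabilityMeasure μ] (hZ : iIndepFun Z μ)
    (hm : ∀ i, Measurable (Z i)) {β γ : Type*} [MeasurableSpace β] [MeasurableSpace γ]
    {F : (ι → E) → β} {G : (ι → E) → γ} (hF : Measurable F) (hG : Measurable G)
    {A B : Finset ι} (hFA : DependsOn F (A : Set ι)) (hGB : DependsOn G (B : Set ι))
    (hAB : Disjoint A B) :
    IndepFun (fun ω => F fun i => Z i ω) (fun ω => G fun i => Z i ω) μ := by
  cases isEmpty_or_nonempty ι with
  | inl h =>
    have h1 : (fun ω => F fun i => Z i ω) = fun _ => F (fun i => h.elim i) := by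
      ext ω; congr 1; ext i; exact h.elim i
    rw [h1]
    exact indepFun_const_left _ _
  | inr h =>
    have : Nonempty E := ⟨Z h.some (μ.nonempty_of_neZero.some)⟩
    obtain ⟨F', hF', hF1⟩ := exists_measurable_factor hF A hFA
    obtain ⟨G', hG', hG1⟩ := exists_measurable_factor hG B hGB
    simp only [hF1, hG1]
    exact (hZ.indepFun_finset A B hAB hm).comp hF' hG'

/-- Fubini's theorem for independent coordinates: the coordinate `c` can be integrated last. -/
lemma integral_eq_integral_update [IsProbabilityMeasure μ] (hZ : iIndepFun Z μ)
    (hm : ∀ i, Measurable (Z i)) (c : ι) {F : (ι → E) → ℝ} (hF : Measurable F)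
    {A : Finset ι} (hFA : DependsOn F (A : Set ι)) {C : ℝ} (hC : ∀ z, |F z| ≤ C) :
    ∫ ω, F (fun i => Z i ω) ∂μ =
      ∫ x, (∫ ω, F (Function.update (fun i => Z i ω) c x) ∂μ) ∂(μ.map (Z c)) := by
  have : Nonempty E := ⟨Z c (μ.nonempty_of_neZero.some)⟩
  have hmeas : Measurable fun p : E × (ι → E) => Function.update p.2 c p.1 := by
    refine measurable_pi_lambda _ fun i => ?_
    by_cases h : i = c
    · subst h; simpa using measurable_fst
    · simpa [h, Function.comp_def] using (measurable_pi_apply i).comp measurable_snd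
  have hZm : Measurable fun ω => (fun i => Z i ω) := measurable_pi_lambda _ hm
  -- the function `F` as a function of the pair (coordinate `c`, the other coordinates in `A`)
  let B := A.erase c
  obtain ⟨G, hG, hG1⟩ : ∃ G : E × (B → E) → ℝ, Measurable G ∧
      ∀ x (z : ι → E), F (Function.update z c x) = G (x, fun i => z i) := by
    refine ⟨fun p => F (Function.update (extendArbitrary B p.2) c p.1),
      hF.comp (hmeas.comp (measurable_fst.prodMk
        ((measurable_extendArbitrary B).comp measurable_snd))), fun x z => hFA fun i hi => ?_⟩
    by_cases h : i = c
    · subst h; simp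
    · have : i ∈ B := Finset.mem_erase.2 ⟨h, hi⟩
      simp [h, this, extendArbitrary]
  have hind : IndepFun (Z c) (fun ω (i : B) => Z i ω) μ :=
    indepFun_of_dependsOn (A := {c}) (B := B) hZ hm (F := fun z => z c)
      (G := fun z (i : B) => z i) (measurable_pi_apply c)
      (measurable_pi_lambda _ fun i => measurable_pi_apply _)
      (fun x y h => h c (by simp)) (fun x y h => funext fun i => h i i.2) (by simp [B])
  have hBm : Measurable fun ω (i : B) => Z i ω := measurable_pi_lambda _ fun i => hm i
  have hmap := (indepFun_iff_map_prod_eq_prod_map_map (hm c).aemeasurable hBm.aemeasurable).1 hind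
  have h1 : ∀ ω, F (fun i => Z i ω) = G (Z c ω, fun i : B => Z i ω) := fun ω => by
    rw [← hG1 (Z c ω) fun i => Z i ω]; simp
  simp_rw [h1, hG1]
  have : IsProbabilityMeasure (μ.map (Z c)) := Measure.isProbabilityMeasure_map (hm c).aemeasurable
  have : IsProbabilityMeasure (μ.map (fun ω (i : B) => Z i ω)) :=
    Measure.isProbabilityMeasure_map hBm.aemeasurable
  rw [← integral_map (φ := fun ω => (Z c ω, fun i : B => Z i ω))
    ((hm c).prodMk hBm).aemeasurable hG.aestronglyMeasurable, hmap, integral_prod]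
  · congr with x
    rw [integral_map hBm.aemeasurable]
    exact (hG.comp measurable_prodMk_left).aestronglyMeasurable
  · -- a bound for `G` is only known along the sample, which is all that integrability needs
    rw [← hmap, integrable_map_measure hG.aestronglyMeasurable ((hm c).prodMk hBm).aemeasurable]
    refine Integrable.of_bound (C := C)
      (hG.comp ((hm c).prodMk hBm)).aestronglyMeasurable (ae_of_all _ fun ω => ?_)
    simpa [← h1] using hC _

/-- If two functions of independent coordinates share only the coordinate `c`, they are independent
given that coordinate. -/
lemma integral_mul_eq_integral_update [IsProbabilityMeasure μ] (hZ : iIndepFun Z μ)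
    (hm : ∀ i, Measurable (Z i)) (c : ι) {F G : (ι → E) → ℝ} (hF : Measurable F)
    (hG : Measurable G) {A B : Finset ι} (hFA : DependsOn F (A : Set ι))
    (hGB : DependsOn G (B : Set ι)) (hAB : A ∩ B ⊆ {c}) {C : ℝ} (hFC : ∀ z, |F z| ≤ C)
    (hGC : ∀ z, |G z| ≤ C) :
    ∫ ω, F (fun i => Z i ω) * G (fun i => Z i ω) ∂μ =
      ∫ x, (∫ ω, F (Function.update (fun i => Z i ω) c x) ∂μ) *
        (∫ ω, G (Function.update (fun i => Z i ω) c x) ∂μ) ∂(μ.map (Z c)) := by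
  have hZm : Measurable fun ω => (fun i => Z i ω) := measurable_pi_lambda _ hm
  rw [integral_eq_integral_update hZ hm c (F := fun z => F z * G z) (A := A ∪ B) (hF.mul hG)
    (C := C * C)]
  · congr with x
    have hu : Measurable fun z : ι → E => Function.update z c x := measurable_update_left
    have hdep : ∀ {K : (ι → E) → ℝ} {D : Finset ι}, DependsOn K (D : Set ι) →
        DependsOn (fun z => K (Function.update z c x)) ((D.erase c : Finset ι) : Set ι) := by
      intro K D hK z w h
      refine hK fun i hi => ?_
      by_cases hic : i = c
      · subst hic; simp
      · simpa [hic] using h i (by simpa [hic] using hi)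
    refine IndepFun.integral_fun_mul_eq_mul_integral
      (indepFun_of_dependsOn hZ hm (hF.comp hu) (hG.comp hu) (hdep hFA) (hdep hGB) ?_)
      ((hF.comp hu).comp hZm).aestronglyMeasurable ((hG.comp hu).comp hZm).aestronglyMeasurable
    rw [Finset.disjoint_left]
    intro i hi hi'
    have := hAB (Finset.mem_inter.2 ⟨Finset.mem_of_mem_erase hi, Finset.mem_of_mem_erase hi'⟩)
    exact (Finset.mem_erase.1 hi).1 (by simpa using this)
  · intro z w h
    simp only
    rw [hFA fun i hi => h i (by simp [Finset.mem_coe.1 hi]),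
      hGB fun i hi => h i (by simp [Finset.mem_coe.1 hi])]
  · intro z
    rw [abs_mul]
    exact mul_le_mul (hFC z) (hGC z) (abs_nonneg _) ((abs_nonneg _).trans (hFC z))

end Independence

lemma integral_prod_eq_prod_integral {Ω ι E : Type*} [MeasurableSpace Ω] [MeasurableSpace E]
    {μ : Measure Ω} {Z : ι → Ω → E} (hZ : iIndepFun Z μ)
    (hm : ∀ i, Measurable (Z i)) (A : Finset ι) {φ : ι → E → ℝ} (hφ : ∀ i, Measurable (φ i)) :
    ∫ ω, ∏ i ∈ A, φ i (Z i ω) ∂μ = ∏ i ∈ A, ∫ x, φ i x ∂(μ.map (Z i)) := by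
  have h0 : iIndepFun (fun i : A => Z i) μ := hZ.precomp Subtype.val_injective
  have h := h0.integral_fun_prod_comp (f := fun i : A => φ i) (fun i => (hm i).aemeasurable)
    (fun i => (hφ i).aestronglyMeasurable)
  simp_rw [← Finset.prod_coe_sort A]
  rw [h]
  refine Finset.prod_congr rfl fun i _ => ?_
  rw [integral_map (hm i).aemeasurable (hφ i).aestronglyMeasurable]

/-! ### Overlap counts and second moments of averages over subsets -/

section Counting

lemma choose_mul_pow_le {r n : ℕ} (hrn : r ≤ n) (k : ℕ) :
    r.choose k * n ^ k ≤ n.choose k * r ^ k := by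
  induction k with
  | zero => simp
  | succ k ih =>
    refine Nat.le_of_mul_le_mul_right (c := k + 1) ?_ (Nat.succ_pos k)
    have h1 : (r - k) * n ≤ (n - k) * r := by
      rw [Nat.sub_mul, Nat.sub_mul, Nat.mul_comm r n]
      exact Nat.sub_le_sub_left (Nat.mul_le_mul_left k hrn) _
    calc r.choose (k + 1) * n ^ (k + 1) * (k + 1)
        = (r.choose (k + 1) * (k + 1)) * n ^ k * n := by ring
      _ = (r.choose k * n ^ k) * ((r - k) * n) := by rw [Nat.choose_succ_right_eq]; ring
      _ ≤ (n.choose k * r ^ k) * ((n - k) * r) := Nat.mul_le_mul ih h1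
      _ = (n.choose (k + 1) * (k + 1)) * r ^ k * r := by rw [Nat.choose_succ_right_eq]; ring
      _ = n.choose (k + 1) * r ^ (k + 1) * (k + 1) := by ring

/-- A uniformly random `r`-subset of an `n`-set contains a given set `K` with probability at most
`(r / n) ^ |K|`. -/
lemma card_filter_subset_le {α : Type*} [DecidableEq α] (K t : Finset α) {r : ℕ}
    (hr : r ≤ t.card) :
    (((t.powersetCard r).filter (K ⊆ ·)).card : ℝ) ≤
      (r / t.card : ℝ) ^ K.card * (t.card.choose r : ℝ) := by
  by_cases hK : K ⊆ t ∧ K.card ≤ r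
  · rw [Finset.card_filter_powersetCard_subset K t r hK.1 hK.2]
    have h1 := Nat.choose_mul (n := t.card) (k := r) (s := K.card) hK.2
    have h2 := choose_mul_pow_le hr K.card
    rcases Nat.eq_zero_or_pos t.card with h0 | h0
    · have : K = ∅ := by
        rw [Finset.card_eq_zero] at h0; subst h0; exact Finset.subset_empty.1 hK.1
      subst this
      simp
    have hc : 0 < t.card.choose K.card := Nat.choose_pos (hK.2.trans hr)
    rw [div_pow, div_mul_eq_mul_div, le_div_iff₀ (by positivity)]
    refine le_of_mul_le_mul_left ?_ (Nat.cast_pos (α := ℝ).2 hc)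
    norm_cast
    calc t.card.choose K.card * ((t.card - K.card).choose (r - K.card) * t.card ^ K.card)
        = t.card.choose r * (r.choose K.card * t.card ^ K.card) := by
          rw [← mul_assoc, ← h1, mul_assoc]
      _ ≤ t.card.choose r * (t.card.choose K.card * r ^ K.card) := Nat.mul_le_mul_left _ h2
      _ = _ := by ring
  · have : (t.powersetCard r).filter (K ⊆ ·) = ∅ := by
      rw [Finset.filter_eq_empty_iff]
      intro S hS hKS
      rw [Finset.mem_powersetCard] at hS
      exact hK ⟨hKS.trans hS.1, hS.2 ▸ Finset.card_le_card hKS⟩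
    rw [this, Finset.card_empty, Nat.cast_zero]
    positivity

/-- The index sets of a two-sample `U`-statistic: pairs of an `r₁`-subset of the first sample and
an `r₂`-subset of the second. -/
def samplePairs (r₁ r₂ n₁ n₂ : ℕ) : Finset (Finset ℕ × Finset ℕ) :=
  (Finset.range n₁).powersetCard r₁ ×ˢ (Finset.range n₂).powersetCard r₂

lemma mem_samplePairs {r₁ r₂ n₁ n₂ : ℕ} {s : Finset ℕ × Finset ℕ} :
    s ∈ samplePairs r₁ r₂ n₁ n₂ ↔ (s.1 ⊆ Finset.range n₁ ∧ s.1.card = r₁) ∧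
      (s.2 ⊆ Finset.range n₂ ∧ s.2.card = r₂) := by
  simp [samplePairs, Finset.mem_product, Finset.mem_powersetCard]

lemma card_samplePairs (r₁ r₂ n₁ n₂ : ℕ) :
    (samplePairs r₁ r₂ n₁ n₂).card = n₁.choose r₁ * n₂.choose r₂ := by
  simp [samplePairs]

lemma card_samplePairs_filter_le {r₁ r₂ n₁ n₂ : ℕ} (h₁ : r₁ ≤ n₁) (h₂ : r₂ ≤ n₂)
    (K : Finset (ℕ ⊕ ℕ)) :
    (((samplePairs r₁ r₂ n₁ n₂).filter fun s => K ⊆ s.1.disjSum s.2).card : ℝ) ≤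
      (r₁ / n₁ + r₂ / n₂ : ℝ) ^ K.card * (samplePairs r₁ r₂ n₁ n₂).card := by
  have h : (samplePairs r₁ r₂ n₁ n₂).filter (fun s => K ⊆ s.1.disjSum s.2) =
      ((Finset.range n₁).powersetCard r₁).filter (K.toLeft ⊆ ·) ×ˢ
        ((Finset.range n₂).powersetCard r₂).filter (K.toRight ⊆ ·) := by
    ext s
    simp only [samplePairs, Finset.mem_filter, Finset.mem_product, Finset.subset_disjSum]
    tauto
  have a := card_filter_subset_le K.toLeft (Finset.range n₁) (r := r₁) (by simpa)
  have b := card_filter_subset_le K.toRight (Finset.range n₂) (r := r₂) (by simpa)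
  rw [Finset.card_range] at a b
  rw [h, Finset.card_product, card_samplePairs, ← Finset.card_toLeft_add_card_toRight (u := K),
    pow_add]
  push_cast
  have p1 : (0 : ℝ) ≤ r₁ / n₁ := by positivity
  have p2 : (0 : ℝ) ≤ r₂ / n₂ := by positivity
  calc _ ≤ ((r₁ / n₁ : ℝ) ^ K.toLeft.card * (n₁.choose r₁ : ℝ)) *
        ((r₂ / n₂ : ℝ) ^ K.toRight.card * (n₂.choose r₂ : ℝ)) := by gcongr
    _ ≤ ((r₁ / n₁ + r₂ / n₂ : ℝ) ^ K.toLeft.card * (n₁.choose r₁ : ℝ)) *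
        ((r₁ / n₁ + r₂ / n₂ : ℝ) ^ K.toRight.card * (n₂.choose r₂ : ℝ)) := by
        gcongr <;> linarith
    _ = _ := by ring

/-- The second moment of an average of random variables indexed by `r`-element sets, when their
mixed moments are controlled by the size of the overlap of the index sets. -/
lemma integral_sq_average_le {Ω ι κ : Type*} [MeasurableSpace Ω] [DecidableEq ι] {μ : Measure Ω}
    (P : Finset κ) (A : κ → Finset ι) (D : κ → Ω → ℝ) {r : ℕ} {ρ : ℝ} {v : ℕ → ℝ}
    (hP : P.Nonempty) (hA : ∀ s ∈ P, (A s).card = r)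
    (hcount : ∀ K : Finset ι, ((P.filter fun s => K ⊆ A s).card : ℝ) ≤ ρ ^ K.card * P.card)
    (hv : ∀ m, 0 ≤ v m)
    (hint : ∀ s ∈ P, ∀ t ∈ P, Integrable (fun ω => D s ω * D t ω) μ)
    (hD : ∀ s ∈ P, ∀ t ∈ P, ∫ ω, D s ω * D t ω ∂μ ≤ v (A s ∩ A t).card) :
    ∫ ω, ((P.card : ℝ)⁻¹ * ∑ s ∈ P, D s ω) ^ 2 ∂μ ≤
      ∑ m ∈ Finset.range (r + 1), (r.choose m : ℝ) * (v m * ρ ^ m) := by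
  have hN : (0 : ℝ) < P.card := by exact_mod_cast hP.card_pos
  have h1 : ∀ ω, ((P.card : ℝ)⁻¹ * ∑ s ∈ P, D s ω) ^ 2 =
      ((P.card : ℝ)⁻¹) ^ 2 * ∑ s ∈ P, ∑ t ∈ P, D s ω * D t ω := fun ω => by
    rw [mul_pow, sq (∑ s ∈ P, D s ω), Finset.sum_mul_sum]
  simp_rw [h1]
  rw [integral_const_mul, integral_finsetSum _ fun s hs => integrable_finsetSum _ (hint s hs)]
  have h2 : ∀ s ∈ P, ∫ ω, ∑ t ∈ P, D s ω * D t ω ∂μ ≤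
      P.card * ∑ m ∈ Finset.range (r + 1), (r.choose m : ℝ) * (v m * ρ ^ m) := by
    intro s hs
    rw [integral_finsetSum _ (hint s hs)]
    calc ∑ t ∈ P, ∫ ω, D s ω * D t ω ∂μ
        ≤ ∑ t ∈ P, v (A s ∩ A t).card := Finset.sum_le_sum (hD s hs)
      _ ≤ ∑ t ∈ P, ∑ K ∈ (A s).powerset, if K ⊆ A t then v K.card else 0 := by
          refine Finset.sum_le_sum fun t _ => ?_
          have := Finset.single_le_sum (s := (A s).powerset)
            (f := fun K => if K ⊆ A t then v K.card else 0) (a := A s ∩ A t)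
            (fun K _ => by split_ifs <;> simp [hv])
            (Finset.mem_powerset.2 Finset.inter_subset_left)
          simpa [Finset.inter_subset_right] using this
      _ = ∑ K ∈ (A s).powerset, (P.filter fun t => K ⊆ A t).card * v K.card := by
          rw [Finset.sum_comm]
          refine Finset.sum_congr rfl fun K _ => ?_
          rw [← Finset.sum_filter, Finset.sum_const, nsmul_eq_mul]
      _ ≤ ∑ K ∈ (A s).powerset, P.card * (v K.card * ρ ^ K.card) := by
          refine Finset.sum_le_sum fun K _ => ?_
          calc _ ≤ ρ ^ K.card * P.card * v K.card :=
                mul_le_mul_of_nonneg_right (hcount K) (hv _)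
            _ = _ := by ring
      _ = _ := by
          rw [← Finset.mul_sum, Finset.sum_powerset_apply_card (fun m => v m * ρ ^ m), hA s hs]
          simp [nsmul_eq_mul]
  calc _ ≤ ((P.card : ℝ)⁻¹) ^ 2 * ∑ s ∈ P,
        (P.card * ∑ m ∈ Finset.range (r + 1), (r.choose m : ℝ) * (v m * ρ ^ m)) := by
        gcongr with s hs
        exact h2 s hs
    _ = _ := by
        rw [Finset.sum_const, nsmul_eq_mul]
        field_simp

end Counting

/-! ### Averages over small balls -/

section Balls

variable {d : ℕ}

open Classical in
/-- The indicator that two points are at distance at most `ε`. -/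
noncomputable def near (ε : ℝ) (u v : Sp d) : ℝ := if dist u v ≤ ε then 1 else 0

/-- The average of `f` over the ball of radius `ε` around `x`, with respect to Lebesgue measure. -/
noncomputable def avg (ε : ℝ) (f : Sp d → ℝ) (x : Sp d) : ℝ :=
  (ballVol d ε)⁻¹ * ∫ y in Metric.closedBall x ε, f y

lemma near_nonneg (ε : ℝ) (u v : Sp d) : 0 ≤ near ε u v := by
  unfold near; split_ifs <;> simp

lemma near_le_one (ε : ℝ) (u v : Sp d) : near ε u v ≤ 1 := by
  unfold near; split_ifs <;> simp

lemma near_comm (ε : ℝ) (u v : Sp d) : near ε u v = near ε v u := by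
  simp [near, dist_comm]

lemma near_eq_indicator (ε : ℝ) (u v : Sp d) :
    near ε u v = (Metric.closedBall u ε).indicator (fun _ => (1 : ℝ)) v := by
  by_cases h : dist u v ≤ ε
  · rw [Set.indicator_of_mem (by rwa [Metric.mem_closedBall, dist_comm]), near, if_pos h]
  · rw [Set.indicator_of_notMem (by rwa [Metric.mem_closedBall, dist_comm]), near, if_neg h]

lemma measurable_near (ε : ℝ) : Measurable fun p : Sp d × Sp d => near ε p.1 p.2 := by
  have hs : MeasurableSet {p : Sp d × Sp d | dist p.1 p.2 ≤ ε} :=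
    (isClosed_le continuous_dist continuous_const).measurableSet
  have h : (fun p : Sp d × Sp d => near ε p.1 p.2) =
      {p : Sp d × Sp d | dist p.1 p.2 ≤ ε}.indicator fun _ => 1 := by
    ext p
    by_cases h : dist p.1 p.2 ≤ ε
    · rw [Set.indicator_of_mem (by exact h), near, if_pos h]
    · rw [Set.indicator_of_notMem (by exact h), near, if_neg h]
  rw [h]
  exact measurable_const.indicator hs

lemma measurable_near_right (ε : ℝ) (u : Sp d) : Measurable (near ε u) := by
  have := (measurable_near ε).comp (measurable_prodMk_left (x := u))
  exact this

lemma volume_real_closedBall (x : Sp d) {ε : ℝ} (hε : 0 ≤ ε) :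
    (volume : Measure (Sp d)).real (Metric.closedBall x ε) = ballVol d ε := by
  unfold ballVol Measure.real
  rw [Measure.addHaar_closedBall _ _ hε, Measure.addHaar_closedBall _ _ hε]

lemma ballVol_eq {ε : ℝ} (hε : 0 ≤ ε) : ballVol d ε = ε ^ d * ballVol d 1 := by
  unfold ballVol Measure.real
  rw [Measure.addHaar_closedBall _ _ hε, Measure.addHaar_closedBall _ _ zero_le_one]
  simp [ENNReal.toReal_ofReal, hε]

lemma ballVol_pos {ε : ℝ} (hε : 0 < ε) : 0 < ballVol d ε :=
  ENNReal.toReal_pos (Metric.measure_closedBall_pos volume _ hε).ne'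
    measure_closedBall_lt_top.ne

lemma ballVol_two_mul {ε : ℝ} (hε : 0 ≤ ε) : ballVol d (2 * ε) = 2 ^ d * ballVol d ε := by
  rw [ballVol_eq (by positivity), ballVol_eq hε, mul_pow, mul_assoc]

lemma abs_avg_sub_le {ε : ℝ} (hε : 0 < ε) {f : Sp d → ℝ} {x : Sp d} {l δ : ℝ}
    (hf : IntegrableOn f (Metric.closedBall x ε))
    (h : ∀ y ∈ Metric.closedBall x ε, |f y - l| ≤ δ) : |avg ε f x - l| ≤ δ := by
  have hb := ballVol_pos (d := d) hε
  have hl : ∫ _ in Metric.closedBall x ε, l = ballVol d ε * l := by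
    rw [setIntegral_const, volume_real_closedBall x hε.le, smul_eq_mul]
  have h1 : avg ε f x - l = (ballVol d ε)⁻¹ * ∫ y in Metric.closedBall x ε, (f y - l) := by
    rw [integral_sub hf (integrableOn_const measure_closedBall_lt_top.ne), hl, avg]
    field_simp
  have h2 := norm_setIntegral_le_of_norm_le_const (μ := volume) (f := fun y => f y - l)
    (measure_closedBall_lt_top (x := x) (r := ε)) h
  rw [volume_real_closedBall x hε.le, Real.norm_eq_abs] at h2
  rw [h1, abs_mul, abs_of_pos (inv_pos.2 hb), inv_mul_le_iff₀ hb]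
  linarith

lemma integrableOn_closedBall {f : Sp d → ℝ} (hf : Measurable f) {M : ℝ} (hM : ∀ x, |f x| ≤ M)
    (x : Sp d) (ε : ℝ) : IntegrableOn f (Metric.closedBall x ε) :=
  Measure.integrableOn_of_bounded measure_closedBall_lt_top.ne hf.aestronglyMeasurable
    (M := M) (ae_of_all _ hM)

lemma abs_avg_le {ε : ℝ} (hε : 0 < ε) {f : Sp d → ℝ} (hf : Measurable f) {M : ℝ}
    (hM : ∀ x, |f x| ≤ M) (x : Sp d) : |avg ε f x| ≤ M := by
  simpa using abs_avg_sub_le (l := 0) hε (integrableOn_closedBall hf hM x ε)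
    (fun y _ => by simpa using hM y)

lemma avg_nonneg (ε : ℝ) {f : Sp d → ℝ} (hf : ∀ x, 0 ≤ f x) (x : Sp d) : 0 ≤ avg ε f x :=
  mul_nonneg (inv_nonneg.2 ENNReal.toReal_nonneg) (integral_nonneg hf)

lemma setIntegral_closedBall_eq (ε : ℝ) (f : Sp d → ℝ) (x : Sp d) :
    ∫ y in Metric.closedBall x ε, f y = ∫ y, near ε x y * f y := by
  rw [← integral_indicator Metric.isClosed_closedBall.measurableSet]
  refine integral_congr_ae (ae_of_all _ fun y => ?_)
  simp only [near_eq_indicator]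
  by_cases h : y ∈ Metric.closedBall x ε <;> simp [h]

lemma measurable_avg (ε : ℝ) {f : Sp d → ℝ} (hf : Measurable f) : Measurable (avg ε f) := by
  unfold avg
  simp_rw [setIntegral_closedBall_eq]
  refine Measurable.const_mul ?_ _
  exact (StronglyMeasurable.integral_prod_right (f := fun x y => near ε x y * f y)
    ((measurable_near ε).mul (hf.comp measurable_snd)).stronglyMeasurable).measurable

/-- The filter on pairs `(j, y)` along which `j → ∞` while `y` stays in the ball of radius `ε j`
around `x`. Convergence along it is convergence uniform over these shrinking balls. -/
def shrinking (ε : ℕ → ℝ) (x : Sp d) : Filter (ℕ × Sp d) :=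
  atTop.comap Prod.fst ⊓ 𝓟 {q | dist q.2 x ≤ ε q.1}

lemma eventually_shrinking {ε : ℕ → ℝ} {x : Sp d} {P : ℕ × Sp d → Prop} :
    (∀ᶠ q in shrinking ε x, P q) ↔ ∀ᶠ j in atTop, ∀ y, dist y x ≤ ε j → P (j, y) := by
  rw [shrinking, eventually_inf_principal, eventually_comap]
  constructor
  · exact fun h => h.mono fun j hj y hy => hj (j, y) rfl hy
  · rintro h
    refine h.mono ?_
    rintro j hj ⟨_, y⟩ rfl hy
    exact hj y hy

lemma tendsto_diag_shrinking {ε : ℕ → ℝ} (hε : ∀ j, 0 < ε j) (x : Sp d) :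
    Tendsto (fun j => (j, x)) atTop (shrinking ε x) := by
  intro s hs
  have h : ∀ᶠ q in shrinking ε x, q ∈ s := hs
  rw [eventually_shrinking] at h
  exact h.mono fun j hj => hj x (by simpa using (hε j).le)

lemma tendsto_snd_shrinking {ε : ℕ → ℝ} (hε : Tendsto ε atTop (𝓝 0)) (x : Sp d) :
    Tendsto Prod.snd (shrinking ε x) (𝓝 x) := by
  rw [Metric.tendsto_nhds]
  intro δ hδ
  rw [eventually_shrinking]
  filter_upwards [hε.eventually (gt_mem_nhds hδ)] with j hj y hy
  exact hy.trans_lt hj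

/-- Averages over balls of vanishing radius inherit uniform limits over shrinking balls. -/
lemma tendsto_avg {ε : ℕ → ℝ} (hε : ∀ j, 0 < ε j) {f : ℕ → Sp d → ℝ} {x : Sp d} {l M : ℝ}
    (hf : ∀ j, Measurable (f j)) (hM : ∀ j y, |f j y| ≤ M)
    (h : Tendsto (fun q : ℕ × Sp d => f q.1 q.2) (shrinking ε x) (𝓝 l)) :
    Tendsto (fun j => avg (ε j) (f j) x) atTop (𝓝 l) := by
  rw [Metric.tendsto_nhds] at h ⊢
  intro δ hδ
  have h1 := h (δ / 2) (half_pos hδ)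
  rw [eventually_shrinking] at h1
  filter_upwards [h1] with j hj
  rw [Real.dist_eq]
  refine (abs_avg_sub_le (hε j) (integrableOn_closedBall (hf j) (hM j) x _) fun y hy => ?_).trans_lt
    (half_lt_self hδ)
  exact (hj y hy).le

lemma tendsto_avg_shrinking {ε : ℕ → ℝ} (hε : ∀ j, 0 < ε j) (hε0 : Tendsto ε atTop (𝓝 0))
    {f : Sp d → ℝ} {x : Sp d} {M : ℝ} (hf : Measurable f) (hM : ∀ y, |f y| ≤ M)
    (hx : ContinuousAt f x) :
    Tendsto (fun q : ℕ × Sp d => avg (ε q.1) f q.2) (shrinking ε x) (𝓝 (f x)) := by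
  rw [Metric.tendsto_nhds]
  intro δ hδ
  rw [eventually_shrinking]
  obtain ⟨η, hη, h⟩ := Metric.continuousAt_iff.1 hx (δ / 2) (half_pos hδ)
  filter_upwards [hε0.eventually (gt_mem_nhds (half_pos hη))] with j hj y hy
  rw [Real.dist_eq]
  refine (abs_avg_sub_le (hε j) (integrableOn_closedBall hf hM y _) fun z hz => ?_).trans_lt
    (half_lt_self hδ)
  refine (h ?_).le
  have := dist_triangle z y x
  rw [Metric.mem_closedBall] at hz
  linarith

end Balls

section Densities

variable {d : ℕ}

/-- A bounded probability density on `ℝ^d`, with bound `M`, that is continuous almost everywhere. -/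
structure BoundedDensity (p : Sp d → ℝ) (M : ℝ) : Prop where
  nonneg : ∀ x, 0 ≤ p x
  le : ∀ x, p x ≤ M
  meas : Measurable p
  prob : IsProbabilityMeasure (law p)
  cont : ∀ᵐ x, ContinuousAt p x

lemma measurable_of_finite_discontinuities {p : Sp d → ℝ}
    (hp : {x | ¬ ContinuousAt p x}.Finite) : Measurable p := by
  refine measurable_of_restrict_of_restrict_compl (s := {x | ¬ ContinuousAt p x})
    hp.measurableSet ?_ ?_
  · have := hp.to_subtype
    exact measurable_of_finite _
  · refine Continuous.measurable ?_
    refine continuousOn_iff_continuous_domRestrict.1 fun x hx => ?_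
    exact (by simpa using hx : ContinuousAt p x).continuousWithinAt

lemma ae_continuousAt (hd : 1 ≤ d) {p : Sp d → ℝ} (hp : {x | ¬ ContinuousAt p x}.Finite) :
    ∀ᵐ x, ContinuousAt p x := by
  have : Nonempty (Fin d) := ⟨⟨0, hd⟩⟩
  exact hp.measure_zero volume

variable {p : Sp d → ℝ} {M : ℝ}

lemma BoundedDensity.abs_le (hp : BoundedDensity p M) (x : Sp d) : |p x| ≤ M := by
  rw [abs_of_nonneg (hp.nonneg x)]; exact hp.le x

lemma BoundedDensity.bound_nonneg (hp : BoundedDensity p M) : 0 ≤ M :=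
  (hp.nonneg 0).trans (hp.le 0)

lemma BoundedDensity.integral_law (hp : BoundedDensity p M) (f : Sp d → ℝ) :
    ∫ x, f x ∂(law p) = ∫ x, p x * f x := by
  rw [law, integral_withDensity_eq_integral_toReal_smul hp.meas.ennreal_ofReal (by simp)]
  simp [ENNReal.toReal_ofReal (hp.nonneg _)]

lemma ae_law {P : Sp d → Prop} (h : ∀ᵐ x, P x) :
    ∀ᵐ x ∂(law p), P x :=
  (withDensity_absolutelyContinuous _ _).ae_le h

lemma BoundedDensity.integral_near (hp : BoundedDensity p M) (ε : ℝ) (x : Sp d) :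
    ∫ y, near ε x y ∂(law p) = ballProb (law p) ε x := by
  have := hp.prob
  simp_rw [near_eq_indicator, ballProb]
  rw [integral_indicator_const _ Metric.isClosed_closedBall.measurableSet]
  simp

lemma BoundedDensity.ballProb_eq (hp : BoundedDensity p M) {ε : ℝ} (hε : 0 < ε) (x : Sp d) :
    ballProb (law p) ε x = ballVol d ε * avg ε p x := by
  rw [← hp.integral_near, hp.integral_law, avg, setIntegral_closedBall_eq,
    mul_inv_cancel_left₀ (ballVol_pos hε).ne']
  simp_rw [mul_comm]

lemma BoundedDensity.avg_le (hp : BoundedDensity p M) {ε : ℝ} (hε : 0 < ε) (x : Sp d) :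
    avg ε p x ≤ M :=
  (le_abs_self _).trans (abs_avg_le hε hp.meas hp.abs_le x)

lemma BoundedDensity.avg_nonneg (hp : BoundedDensity p M) (ε : ℝ) (x : Sp d) :
    0 ≤ avg ε p x :=
  RenyiStat.avg_nonneg ε hp.nonneg x

lemma BoundedDensity.ballProb_le (hp : BoundedDensity p M) {ε : ℝ} (hε : 0 < ε) (x : Sp d) :
    ballProb (law p) ε x ≤ ballVol d ε * M := by
  rw [hp.ballProb_eq hε]
  exact mul_le_mul_of_nonneg_left (hp.avg_le hε x) (ballVol_pos hε).le

/-- Bounded convergence with respect to a probability measure. -/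
lemma tendsto_integral_of_bounded {E : Type*} [MeasurableSpace E] {ν : Measure E}
    [IsProbabilityMeasure ν] {F : ℕ → E → ℝ} {f : E → ℝ} {C : ℝ} (hF : ∀ j, Measurable (F j))
    (hC : ∀ j x, |F j x| ≤ C) (h : ∀ᵐ x ∂ν, Tendsto (fun j => F j x) atTop (𝓝 (f x))) :
    Tendsto (fun j => ∫ x, F j x ∂ν) atTop (𝓝 (∫ x, f x ∂ν)) :=
  tendsto_integral_of_dominated_convergence (fun _ => C) (fun j => (hF j).aestronglyMeasurable)
    (integrable_const C) (fun j => ae_of_all _ (hC j)) h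

end Densities

/-! ### Probabilities that points cluster around a centre -/

section Star

variable {Ω ι : Type*} [MeasurableSpace Ω] {d : ℕ}

/-- `Z` is a family of independent random points of `ℝ^d`, with bounded densities `f i`. -/
structure IndepSample (μ : Measure Ω) (Z : ι → Ω → Sp d) (f : ι → Sp d → ℝ) (M : ℝ) : Prop where
  indep : iIndepFun Z μ
  meas : ∀ i, Measurable (Z i)
  map_eq : ∀ i, μ.map (Z i) = law (f i)
  dens : ∀ i, BoundedDensity (f i) M

section

variable {μ : Measure Ω} {Z : ι → Ω → Sp d}
  {f : ι → Sp d → ℝ} {M : ℝ}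

lemma IndepSample.measurable_pi (hs : IndepSample μ Z f M) :
    Measurable fun ω => (fun i => Z i ω) :=
  measurable_pi_lambda _ hs.meas

lemma IndepSample.integral_prod_near (hs : IndepSample μ Z f M) (ε : ℝ) (A : Finset ι)
    (x : Sp d) :
    ∫ ω, ∏ j ∈ A, near ε x (Z j ω) ∂μ = ∏ j ∈ A, ballProb (law (f j)) ε x := by
  rw [integral_prod_eq_prod_integral hs.indep hs.meas A (φ := fun _ => near ε x)
    fun _ => measurable_near_right ε x]
  refine Finset.prod_congr rfl fun j _ => ?_
  rw [hs.map_eq, (hs.dens j).integral_near]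

lemma IndepSample.integrable_of_bounded [IsFiniteMeasure μ] (hs : IndepSample μ Z f M)
    {F : (ι → Sp d) → ℝ}
    (hF : Measurable F) {C : ℝ} (hC : ∀ z, |F z| ≤ C) :
    Integrable (fun ω => F fun i => Z i ω) μ :=
  Integrable.of_bound (hF.comp hs.measurable_pi).aestronglyMeasurable C (ae_of_all _ fun _ => hC _)

end

variable [DecidableEq ι]

/-- The indicator that all the points `z j`, `j ∈ A`, are `ε`-close to the point `z a`. -/
noncomputable def star (ε : ℝ) (A : Finset ι) (a : ι) (z : ι → Sp d) : ℝ :=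
  ∏ j ∈ A.erase a, near ε (z a) (z j)

lemma star_nonneg (ε : ℝ) (A : Finset ι) (a : ι) (z : ι → Sp d) : 0 ≤ star ε A a z :=
  Finset.prod_nonneg fun _ _ => near_nonneg _ _ _

lemma star_le_one (ε : ℝ) (A : Finset ι) (a : ι) (z : ι → Sp d) : star ε A a z ≤ 1 :=
  Finset.prod_le_one (fun _ _ => near_nonneg _ _ _) fun _ _ => near_le_one _ _ _

lemma abs_star_le_one (ε : ℝ) (A : Finset ι) (a : ι) (z : ι → Sp d) : |star ε A a z| ≤ 1 := by
  rw [abs_of_nonneg (star_nonneg _ _ _ _)]; exact star_le_one _ _ _ _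

lemma star_eq_one {ε : ℝ} {A : Finset ι} {a : ι} {z : ι → Sp d}
    (h : ∀ j ∈ A.erase a, dist (z a) (z j) ≤ ε) : star ε A a z = 1 :=
  Finset.prod_eq_one fun j hj => by rw [near, if_pos (h j hj)]

lemma dist_le_of_star_ne_zero {ε : ℝ} {A : Finset ι} {a : ι} {z : ι → Sp d}
    (h : star ε A a z ≠ 0) {j : ι} (hj : j ∈ A.erase a) : dist (z a) (z j) ≤ ε := by
  by_contra hc
  exact h (Finset.prod_eq_zero hj (by rw [near, if_neg hc]))

lemma measurable_star (ε : ℝ) (A : Finset ι) (a : ι) :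
    Measurable (star (d := d) ε A a) := by
  refine Finset.measurable_fun_prod _ fun j _ => ?_
  have h : Measurable fun z : ι → Sp d => (z a, z j) :=
    (measurable_pi_apply a).prodMk (measurable_pi_apply j)
  have := (measurable_near ε).comp h
  exact this

lemma dependsOn_star (ε : ℝ) {A : Finset ι} {a : ι} (ha : a ∈ A) :
    DependsOn (star (d := d) ε A a) (A : Set ι) := by
  intro z w h
  refine Finset.prod_congr rfl fun j hj => ?_
  rw [h a ha, h j (Finset.mem_of_mem_erase hj)]

/-- Two stars sharing a point `c` force all their points into the ball of radius `2ε` around it. -/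
lemma star_mul_star_le {ε : ℝ} (hε : 0 < ε) {A B : Finset ι} {a b c : ι} (ha : a ∈ A) (hb : b ∈ B)
    (hcA : c ∈ A) (hcB : c ∈ B) (z : ι → Sp d) :
    star ε A a z * star ε B b z ≤ star (2 * ε) (A ∪ B) c z := by
  by_cases hA : star ε A a z = 0
  · rw [hA, zero_mul]; exact star_nonneg _ _ _ _
  by_cases hB : star ε B b z = 0
  · rw [hB, mul_zero]; exact star_nonneg _ _ _ _
  have key : ∀ {D : Finset ι} {e : ι}, e ∈ D → c ∈ D → star ε D e z ≠ 0 → ∀ j ∈ D,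
      dist (z c) (z j) ≤ 2 * ε := by
    intro D e _ hc hne j hj
    have h0 : ∀ i ∈ D, dist (z e) (z i) ≤ ε := by
      intro i hi
      by_cases hie : i = e
      · subst hie; simpa using hε.le
      · exact dist_le_of_star_ne_zero hne (Finset.mem_erase.2 ⟨hie, hi⟩)
    have := dist_triangle_left (z c) (z j) (z e)
    linarith [h0 c hc, h0 j hj]
  rw [star_eq_one (A := A ∪ B) (a := c)]
  · exact mul_le_one₀ (star_le_one _ _ _ _) (star_nonneg _ _ _ _) (star_le_one _ _ _ _)
  · intro j hj
    rcases Finset.mem_union.1 (Finset.mem_of_mem_erase hj) with h | h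
    · exact key ha hcA hA j h
    · exact key hb hcB hB j h

variable {μ : Measure Ω} {Z : ι → Ω → Sp d} {f : ι → Sp d → ℝ} {M : ℝ}

lemma IndepSample.integral_star_update_self (hs : IndepSample μ Z f M) (ε : ℝ) (A : Finset ι)
    (a : ι) (x : Sp d) :
    ∫ ω, star ε A a (Function.update (fun i => Z i ω) a x) ∂μ =
      ∏ j ∈ A.erase a, ballProb (law (f j)) ε x := by
  rw [← hs.integral_prod_near]
  congr with ω
  refine Finset.prod_congr rfl fun j hj => ?_
  simp [Finset.ne_of_mem_erase hj]

variable [IsProbabilityMeasure μ]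

lemma IndepSample.integral_star (hs : IndepSample μ Z f M) (ε : ℝ) {A : Finset ι}
    {a : ι} (ha : a ∈ A) :
    ∫ ω, star ε A a (fun i => Z i ω) ∂μ =
      ∫ x, ∏ j ∈ A.erase a, ballProb (law (f j)) ε x ∂(law (f a)) := by
  rw [integral_eq_integral_update hs.indep hs.meas a (measurable_star ε A a)
    (dependsOn_star ε ha) (abs_star_le_one ε A a), hs.map_eq]
  simp_rw [hs.integral_star_update_self]

/-- The mean of a star when one of the points other than its centre is fixed. -/
lemma IndepSample.integral_star_update_of_ne (hs : IndepSample μ Z f M) (ε : ℝ) {A : Finset ι}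
    {a c : ι} (ha : a ∈ A) (hc : c ∈ A) (hca : c ≠ a) (x : Sp d) :
    ∫ ω, star ε A a (Function.update (fun i => Z i ω) c x) ∂μ =
      ∫ y, near ε x y * ∏ j ∈ (A.erase a).erase c, ballProb (law (f j)) ε y ∂(law (f a)) := by
  have hdep : DependsOn (fun z : ι → Sp d => star ε A a (Function.update z c x)) (A : Set ι) := by
    intro z w h
    refine dependsOn_star ε ha fun i hi => ?_
    by_cases hic : i = c
    · subst hic; simp
    · simpa [hic] using h i hi
  rw [integral_eq_integral_update hs.indep hs.meas a
    (F := fun z => star ε A a (Function.update z c x))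
    ((measurable_star ε A a).comp measurable_update_left) hdep
    (fun z => abs_star_le_one ε A a _), hs.map_eq]
  congr with y
  rw [← hs.integral_prod_near, ← integral_const_mul]
  congr with ω
  have hc' : c ∈ A.erase a := Finset.mem_erase.2 ⟨hca, hc⟩
  rw [star, ← Finset.mul_prod_erase _ _ hc']
  congr 1
  · simp [hca.symm, near_comm ε x y]
  · refine Finset.prod_congr rfl fun j hj => ?_
    have h1 := Finset.ne_of_mem_erase hj
    have h2 := Finset.ne_of_mem_erase (Finset.mem_of_mem_erase hj)
    simp [h1, h2, hca.symm]

lemma IndepSample.integral_star_le (hs : IndepSample μ Z f M) {ε : ℝ} (hε : 0 < ε) {A : Finset ι}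
    {a : ι} (ha : a ∈ A) :
    ∫ ω, star ε A a (fun i => Z i ω) ∂μ ≤ (ballVol d ε * M) ^ (A.card - 1) := by
  have := (hs.dens a).prob
  rw [hs.integral_star ε ha]
  have h : ∀ x, ∏ j ∈ A.erase a, ballProb (law (f j)) ε x ≤ (ballVol d ε * M) ^ (A.card - 1) := by
    intro x
    rw [← Finset.card_erase_of_mem ha, ← Finset.prod_const]
    exact Finset.prod_le_prod (fun j _ => ENNReal.toReal_nonneg)
      fun j _ => (hs.dens j).ballProb_le hε x
  calc _ ≤ ∫ _, (ballVol d ε * M) ^ (A.card - 1) ∂(law (f a)) :=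
        integral_mono_of_nonneg
          (ae_of_all _ fun x => Finset.prod_nonneg fun j _ => ENNReal.toReal_nonneg)
          (integrable_const _) (ae_of_all _ h)
    _ = _ := by simp

lemma IndepSample.integral_star_mul_star_le (hs : IndepSample μ Z f M) {ε : ℝ} (hε : 0 < ε)
    {A B : Finset ι} {a b c : ι} (ha : a ∈ A) (hb : b ∈ B) (hcA : c ∈ A) (hcB : c ∈ B) :
    ∫ ω, star ε A a (fun i => Z i ω) * star ε B b (fun i => Z i ω) ∂μ ≤
      (2 ^ d * M * ballVol d ε) ^ ((A ∪ B).card - 1) := by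
  have h := hs.integral_star_le (ε := 2 * ε) (by positivity) (Finset.mem_union_left B hcA)
  rw [ballVol_two_mul hε.le] at h
  calc _ ≤ ∫ ω, star (2 * ε) (A ∪ B) c (fun i => Z i ω) ∂μ :=
        integral_mono_of_nonneg
          (ae_of_all _ fun ω => mul_nonneg (star_nonneg _ _ _ _) (star_nonneg _ _ _ _))
          (hs.integrable_of_bounded (measurable_star _ _ _) (abs_star_le_one _ _ _))
          (ae_of_all _ fun ω => star_mul_star_le hε ha hb hcA hcB _)
    _ ≤ _ := h.trans_eq (by ring_nf)

end Star

/-! ### The kernel of the `U`-statistic -/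

section Kernel

variable {Ω : Type*} [MeasurableSpace Ω] {d : ℕ}

/-- The symmetrized kernel of the `U`-statistic on an index set `A` of the joint sample, in which
the first sample is indexed by `Sum.inl` and the second one by `Sum.inr`. -/
noncomputable def kernel (ε : ℝ) (A : Finset (ℕ ⊕ ℕ)) (z : ℕ ⊕ ℕ → Sp d) : ℝ :=
  (A.toLeft.card : ℝ)⁻¹ * ∑ a ∈ A.toLeft, star ε A (Sum.inl a) z

/-- The kernel, normalized so that its mean stays of order one as `ε → 0`. -/
noncomputable def normKernel (ε : ℝ) (A : Finset (ℕ ⊕ ℕ)) (z : ℕ ⊕ ℕ → Sp d) : ℝ :=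
  kernel ε A z / ballVol d ε ^ (A.card - 1)

/-- The densities of the joint sample. -/
def jointDensity (pX pY : Sp d → ℝ) : ℕ ⊕ ℕ → Sp d → ℝ := Sum.elim (fun _ => pX) fun _ => pY

lemma psi_eq_kernel {ε : ℝ} (hε : 0 < ε) (x y : ℕ → Sp d) (S T : Finset ℕ) :
    psi ε x y S T = kernel ε (S.disjSum T) (Sum.elim x y) := by
  unfold psi kernel
  rw [Finset.toLeft_disjSum]
  congr 1
  refine Finset.sum_congr rfl fun i hi => ?_
  unfold psiAt
  split_ifs with h
  · rw [star_eq_one]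
    intro j hj
    rcases j with j | j
    · exact h.1 j (by simpa using Finset.mem_of_mem_erase hj)
    · exact h.2 j (by simpa using Finset.mem_of_mem_erase hj)
  · by_contra hne
    refine h ⟨fun j hj => ?_, fun k hk => ?_⟩
    · by_cases hji : j = i
      · subst hji; simpa using hε.le
      · exact dist_le_of_star_ne_zero (Ne.symm hne) (j := Sum.inl j)
          (Finset.mem_erase.2 ⟨by simpa using hji, by simpa using hj⟩)
    · exact dist_le_of_star_ne_zero (Ne.symm hne) (j := Sum.inr k)
        (Finset.mem_erase.2 ⟨by simp, by simpa using hk⟩)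

lemma UTilde_eq_average {ε : ℝ} (hε : 0 < ε) (r₁ r₂ n₁ n₂ : ℕ) (x y : ℕ → Sp d) :
    UTilde r₁ r₂ n₁ n₂ ε x y = ((samplePairs r₁ r₂ n₁ n₂).card : ℝ)⁻¹ *
      ∑ s ∈ samplePairs r₁ r₂ n₁ n₂, normKernel ε (s.1.disjSum s.2) (Sum.elim x y) := by
  unfold UTilde U
  rw [card_samplePairs, Nat.cast_mul, mul_inv, mul_div_assoc, ← Finset.sum_product', Finset.sum_div]
  congr 1
  refine Finset.sum_congr rfl fun s hs => ?_
  have h := mem_samplePairs.1 hs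
  rw [normKernel, psi_eq_kernel hε, Finset.card_disjSum, h.1.2, h.2.2]

lemma kernel_nonneg (ε : ℝ) (A : Finset (ℕ ⊕ ℕ)) (z : ℕ ⊕ ℕ → Sp d) : 0 ≤ kernel ε A z :=
  mul_nonneg (by positivity) (Finset.sum_nonneg fun _ _ => star_nonneg _ _ _ _)

lemma kernel_le_one (ε : ℝ) (A : Finset (ℕ ⊕ ℕ)) (z : ℕ ⊕ ℕ → Sp d) : kernel ε A z ≤ 1 := by
  have h : ∑ a ∈ A.toLeft, star ε A (Sum.inl a) z ≤ A.toLeft.card := by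
    simpa using Finset.sum_le_sum fun a (_ : a ∈ A.toLeft) => star_le_one ε A (Sum.inl a) z
  calc kernel ε A z ≤ (A.toLeft.card : ℝ)⁻¹ * A.toLeft.card := by unfold kernel; gcongr
    _ ≤ 1 := inv_mul_le_one

lemma ballVol_nonneg (ε : ℝ) : 0 ≤ ballVol d ε := ENNReal.toReal_nonneg

lemma normKernel_nonneg (ε : ℝ) (A : Finset (ℕ ⊕ ℕ)) (z : ℕ ⊕ ℕ → Sp d) :
    0 ≤ normKernel ε A z :=
  div_nonneg (kernel_nonneg _ _ _) (pow_nonneg (ballVol_nonneg _) _)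

lemma abs_normKernel_le (ε : ℝ) (A : Finset (ℕ ⊕ ℕ)) (z : ℕ ⊕ ℕ → Sp d) :
    |normKernel ε A z| ≤ 1 / ballVol d ε ^ (A.card - 1) := by
  rw [abs_of_nonneg (normKernel_nonneg _ _ _)]
  exact div_le_div_of_nonneg_right (kernel_le_one _ _ _) (pow_nonneg (ballVol_nonneg _) _)

lemma measurable_normKernel (ε : ℝ) (A : Finset (ℕ ⊕ ℕ)) :
    Measurable (normKernel (d := d) ε A) :=
  ((Finset.measurable_fun_sum _ fun _ _ => measurable_star _ _ _).const_mul _).div_const _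

lemma dependsOn_normKernel (ε : ℝ) (A : Finset (ℕ ⊕ ℕ)) :
    DependsOn (normKernel (d := d) ε A) (A : Set (ℕ ⊕ ℕ)) := by
  intro z w h
  unfold normKernel kernel
  congr 2
  exact Finset.sum_congr rfl fun a ha => dependsOn_star ε (Finset.mem_toLeft.1 ha) h

lemma prod_jointDensity (G : Finset (ℕ ⊕ ℕ)) (F : (Sp d → ℝ) → ℝ) (pX pY : Sp d → ℝ) :
    ∏ j ∈ G, F (jointDensity pX pY j) = F pX ^ G.toLeft.card * F pY ^ G.toRight.card := by
  rw [← Finset.toLeft_disjSum_toRight (u := G), Finset.prod_disjSum]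
  simp [jointDensity]

lemma toLeft_erase_inl (A : Finset (ℕ ⊕ ℕ)) (a : ℕ) :
    (A.erase (Sum.inl a)).toLeft = A.toLeft.erase a := by ext; simp

lemma toRight_erase_inl (A : Finset (ℕ ⊕ ℕ)) (a : ℕ) :
    (A.erase (Sum.inl a)).toRight = A.toRight := by ext; simp

lemma toLeft_erase_inr (A : Finset (ℕ ⊕ ℕ)) (a : ℕ) :
    (A.erase (Sum.inr a)).toLeft = A.toLeft := by ext; simp

lemma toRight_erase_inr (A : Finset (ℕ ⊕ ℕ)) (a : ℕ) :
    (A.erase (Sum.inr a)).toRight = A.toRight.erase a := by ext; simp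

/-- The mean of the normalized kernel when a point of the first sample is fixed at `x`. The first
term comes from the star centred at that point, the other one from the stars centred elsewhere. -/
noncomputable def condMeanX (r₁ r₂ : ℕ) (pX pY : Sp d → ℝ) (ε : ℝ) (x : Sp d) : ℝ :=
  (r₁ : ℝ)⁻¹ * (avg ε pX x ^ (r₁ - 1) * avg ε pY x ^ r₂ +
    ((r₁ : ℝ) - 1) * avg ε (fun y => avg ε pX y ^ (r₁ - 2) * avg ε pY y ^ r₂ * pX y) x)

/-- The mean of the normalized kernel when a point of the second sample is fixed at `x`. -/
noncomputable def condMeanY (r₁ r₂ : ℕ) (pX pY : Sp d → ℝ) (ε : ℝ) (x : Sp d) : ℝ :=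
  avg ε (fun y => avg ε pX y ^ (r₁ - 1) * avg ε pY y ^ (r₂ - 1) * pX y) x

variable {μ : Measure Ω} {Z : ℕ ⊕ ℕ → Ω → Sp d} {pX pY : Sp d → ℝ}
  {M : ℝ} {r₁ r₂ : ℕ} {A B : Finset (ℕ ⊕ ℕ)}

lemma IndepSample.densityX (hs : IndepSample μ Z (jointDensity pX pY) M) : BoundedDensity pX M :=
  hs.dens (Sum.inl 0)

lemma IndepSample.densityY (hs : IndepSample μ Z (jointDensity pX pY) M) : BoundedDensity pY M :=
  hs.dens (Sum.inr 0)

lemma card_eq_of_card_eq (hA₁ : A.toLeft.card = r₁) (hA₂ : A.toRight.card = r₂) :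
    A.card = r₁ + r₂ := by
  rw [← Finset.card_toLeft_add_card_toRight, hA₁, hA₂]

lemma IndepSample.prod_ballProb (hs : IndepSample μ Z (jointDensity pX pY) M) {ε : ℝ}
    (hε : 0 < ε) (G : Finset (ℕ ⊕ ℕ)) (x : Sp d) :
    ∏ j ∈ G, ballProb (law (jointDensity pX pY j)) ε x =
      ballVol d ε ^ G.card * (avg ε pX x ^ G.toLeft.card * avg ε pY x ^ G.toRight.card) := by
  rw [prod_jointDensity G (fun p => ballProb (law p) ε x), hs.densityX.ballProb_eq hε,
    hs.densityY.ballProb_eq hε, ← Finset.card_toLeft_add_card_toRight (u := G), mul_pow, mul_pow,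
    pow_add]
  ring

variable [IsProbabilityMeasure μ]

lemma integral_normKernel (hs : IndepSample μ Z (jointDensity pX pY) M) (ε : ℝ) (hr₁ : 1 ≤ r₁)
    (hA₁ : A.toLeft.card = r₁) (hA₂ : A.toRight.card = r₂) :
    ∫ ω, normKernel ε A (fun i => Z i ω) ∂μ = qTilde r₁ r₂ pX pY ε := by
  unfold normKernel kernel
  rw [integral_div, integral_const_mul, integral_finsetSum _ fun a _ =>
    hs.integrable_of_bounded (measurable_star _ _ _) (abs_star_le_one _ _ _)]
  have h : ∀ a ∈ A.toLeft, ∫ ω, star ε A (Sum.inl a) (fun i => Z i ω) ∂μ = qEps r₁ r₂ pX pY ε := by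
    intro a ha
    rw [hs.integral_star ε (Finset.mem_toLeft.1 ha), qEps]
    congr with x
    rw [prod_jointDensity _ (fun p => ballProb (law p) ε x), toLeft_erase_inl, toRight_erase_inl,
      Finset.card_erase_of_mem ha, hA₁, hA₂]
  rw [Finset.sum_congr rfl h, Finset.sum_const, nsmul_eq_mul, hA₁, qTilde,
    card_eq_of_card_eq hA₁ hA₂, inv_mul_cancel_left₀]
  positivity

lemma IndepSample.integral_star_inl_update (hs : IndepSample μ Z (jointDensity pX pY) M) {ε : ℝ}
    (hε : 0 < ε) {a : ℕ} {c : ℕ ⊕ ℕ} (ha : Sum.inl a ∈ A) (hc : c ∈ A) (hca : c ≠ Sum.inl a)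
    (x : Sp d) :
    ∫ ω, star ε A (Sum.inl a) (Function.update (fun i => Z i ω) c x) ∂μ =
      ballVol d ε ^ (A.card - 1) * avg ε (fun y =>
        avg ε pX y ^ ((A.erase (Sum.inl a)).erase c).toLeft.card *
        avg ε pY y ^ ((A.erase (Sum.inl a)).erase c).toRight.card * pX y) x := by
  have hc' : c ∈ A.erase (Sum.inl a) := Finset.mem_erase.2 ⟨hca, hc⟩
  have hcard : ((A.erase (Sum.inl a)).erase c).card + 1 = A.card - 1 := by
    rw [Finset.card_erase_add_one hc', Finset.card_erase_of_mem ha]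
  rw [hs.integral_star_update_of_ne ε ha hc hca]
  simp_rw [hs.prod_ballProb hε]
  have hl : jointDensity pX pY (Sum.inl a) = pX := rfl
  rw [hl, hs.densityX.integral_law, avg, ← hcard, pow_succ, mul_assoc,
    mul_inv_cancel_left₀ (ballVol_pos hε).ne', setIntegral_closedBall_eq, ← integral_const_mul]
  congr with y
  ring

lemma integral_normKernel_update_inl (hs : IndepSample μ Z (jointDensity pX pY) M) {ε : ℝ}
    (hε : 0 < ε) (hA₁ : A.toLeft.card = r₁) (hA₂ : A.toRight.card = r₂) {c : ℕ}
    (hc : Sum.inl c ∈ A) (x : Sp d) :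
    ∫ ω, normKernel ε A (Function.update (fun i => Z i ω) (Sum.inl c) x) ∂μ =
      condMeanX r₁ r₂ pX pY ε x := by
  have hb := (pow_pos (ballVol_pos (d := d) hε) (A.card - 1)).ne'
  have hc' := Finset.mem_toLeft.2 hc
  unfold normKernel kernel
  rw [integral_div, integral_const_mul, integral_finsetSum _ fun a _ =>
    hs.integrable_of_bounded (F := fun z => star ε A (Sum.inl a) (Function.update z (Sum.inl c) x))
      ((measurable_star _ _ _).comp measurable_update_left) (fun z => abs_star_le_one _ _ _ _),
    ← Finset.add_sum_erase _ _ hc', hs.integral_star_update_self, hs.prod_ballProb hε,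
    Finset.card_erase_of_mem hc, toLeft_erase_inl, toRight_erase_inl,
    Finset.card_erase_of_mem hc', hA₁, hA₂]
  have h : ∀ a ∈ A.toLeft.erase c,
      ∫ ω, star ε A (Sum.inl a) (Function.update (fun i => Z i ω) (Sum.inl c) x) ∂μ =
      ballVol d ε ^ (A.card - 1) *
        avg ε (fun y => avg ε pX y ^ (r₁ - 2) * avg ε pY y ^ r₂ * pX y) x := by
    intro a ha
    have hac := Finset.ne_of_mem_erase ha
    have ha' := Finset.mem_of_mem_erase ha
    rw [hs.integral_star_inl_update hε (Finset.mem_toLeft.1 ha') hc (by simpa using hac.symm),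
      toLeft_erase_inl, toRight_erase_inl, toLeft_erase_inl, toRight_erase_inl,
      Finset.card_erase_of_mem (Finset.mem_erase.2 ⟨hac.symm, hc'⟩), Finset.card_erase_of_mem ha',
      hA₁, hA₂, Nat.sub_sub]
  have hr : 1 ≤ r₁ := hA₁ ▸ Finset.card_pos.2 ⟨c, hc'⟩
  rw [Finset.sum_congr rfl h, Finset.sum_const, Finset.card_erase_of_mem hc', hA₁, nsmul_eq_mul,
    Nat.cast_sub hr, condMeanX, Nat.cast_one]
  field_simp

lemma integral_normKernel_update_inr (hs : IndepSample μ Z (jointDensity pX pY) M) {ε : ℝ}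
    (hε : 0 < ε) (hr₁ : 1 ≤ r₁) (hA₁ : A.toLeft.card = r₁) (hA₂ : A.toRight.card = r₂) {c : ℕ}
    (hc : Sum.inr c ∈ A) (x : Sp d) :
    ∫ ω, normKernel ε A (Function.update (fun i => Z i ω) (Sum.inr c) x) ∂μ =
      condMeanY r₁ r₂ pX pY ε x := by
  have hb := (pow_pos (ballVol_pos (d := d) hε) (A.card - 1)).ne'
  have hc' := Finset.mem_toRight.2 hc
  unfold normKernel kernel
  rw [integral_div, integral_const_mul, integral_finsetSum _ fun a _ =>
    hs.integrable_of_bounded (F := fun z => star ε A (Sum.inl a) (Function.update z (Sum.inr c) x))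
      ((measurable_star _ _ _).comp measurable_update_left) (fun z => abs_star_le_one _ _ _ _)]
  have h : ∀ a ∈ A.toLeft,
      ∫ ω, star ε A (Sum.inl a) (Function.update (fun i => Z i ω) (Sum.inr c) x) ∂μ =
      ballVol d ε ^ (A.card - 1) * condMeanY r₁ r₂ pX pY ε x := by
    intro a ha
    rw [hs.integral_star_inl_update hε (Finset.mem_toLeft.1 ha) hc (by simp),
      toLeft_erase_inr, toRight_erase_inr, toLeft_erase_inl, toRight_erase_inl,
      Finset.card_erase_of_mem ha, Finset.card_erase_of_mem hc', hA₁, hA₂, condMeanY]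
  have hr : (r₁ : ℝ) ≠ 0 := by positivity
  rw [Finset.sum_congr rfl h, Finset.sum_const, hA₁, nsmul_eq_mul]
  field_simp

/-- The mixed second moments of the normalized kernels grow with the overlap `|A ∩ B|`. -/
lemma integral_normKernel_mul_le (hs : IndepSample μ Z (jointDensity pX pY) M) {ε : ℝ}
    (hε : 0 < ε) (hA₁ : A.toLeft.card = r₁) (hA₂ : A.toRight.card = r₂)
    (hB₁ : B.toLeft.card = r₁) (hB₂ : B.toRight.card = r₂) (hAB : 1 ≤ (A ∩ B).card) :
    ∫ ω, normKernel ε A (fun i => Z i ω) * normKernel ε B (fun i => Z i ω) ∂μ ≤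
      (max 1 (2 ^ d * M)) ^ (2 * (r₁ + r₂)) * ((ballVol d ε)⁻¹) ^ ((A ∩ B).card - 1) := by
  have hb := ballVol_pos (d := d) hε
  set b := ballVol d ε with hb_def
  obtain ⟨c, hc⟩ := Finset.card_pos.1 hAB
  obtain ⟨hcA, hcB⟩ := Finset.mem_inter.1 hc
  have hA := card_eq_of_card_eq hA₁ hA₂
  have hB := card_eq_of_card_eq hB₁ hB₂
  have hU := Finset.card_union_add_card_inter A B
  have hI : (A ∩ B).card ≤ A.card := Finset.card_le_card Finset.inter_subset_left
  set m := (A ∩ B).card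
  have hMpos := hs.densityX.bound_nonneg
  -- the bound for a pair of stars
  set L := max 1 (2 ^ d * M)
  have hL : 1 ≤ L := le_max_left _ _
  have hstar : ∀ a ∈ A.toLeft, ∀ e ∈ B.toLeft,
      ∫ ω, star ε A (Sum.inl a) (fun i => Z i ω) * star ε B (Sum.inl e) (fun i => Z i ω) ∂μ ≤
        L ^ (2 * (r₁ + r₂)) * b ^ ((A ∪ B).card - 1) := by
    intro a ha e he
    refine (hs.integral_star_mul_star_le hε (Finset.mem_toLeft.1 ha) (Finset.mem_toLeft.1 he)
      hcA hcB).trans ?_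
    rw [mul_pow]
    refine mul_le_mul_of_nonneg_right ?_ (by positivity)
    calc (2 ^ d * M) ^ ((A ∪ B).card - 1) ≤ L ^ ((A ∪ B).card - 1) :=
          pow_le_pow_left₀ (by positivity) (le_max_right _ _) _
      _ ≤ L ^ (2 * (r₁ + r₂)) := pow_le_pow_right₀ hL (by omega)
  have hint : ∀ a e : ℕ, Integrable (fun ω => star ε A (Sum.inl a) (fun i => Z i ω) *
      star ε B (Sum.inl e) (fun i => Z i ω)) μ := fun a e =>
    hs.integrable_of_bounded (F := fun z => star ε A (Sum.inl a) z * star ε B (Sum.inl e) z)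
      ((measurable_star _ _ _).mul (measurable_star _ _ _)) (C := 1 * 1) fun z => by
        rw [abs_mul]
        exact mul_le_mul (abs_star_le_one _ _ _ _) (abs_star_le_one _ _ _ _) (abs_nonneg _)
          (by simp)
  have hker : ∫ ω, kernel ε A (fun i => Z i ω) * kernel ε B (fun i => Z i ω) ∂μ ≤
      L ^ (2 * (r₁ + r₂)) * b ^ ((A ∪ B).card - 1) := by
    have h1 : ∀ ω, kernel ε A (fun i => Z i ω) * kernel ε B (fun i => Z i ω) =
        ((r₁ : ℝ)⁻¹ * (r₁ : ℝ)⁻¹) * ∑ a ∈ A.toLeft, ∑ e ∈ B.toLeft,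
          star ε A (Sum.inl a) (fun i => Z i ω) * star ε B (Sum.inl e) (fun i => Z i ω) := by
      intro ω
      rw [← Finset.sum_mul_sum, kernel, kernel, hA₁, hB₁]
      ring
    simp_rw [h1]
    rw [integral_const_mul, integral_finsetSum _ fun a _ => integrable_finsetSum _ fun e _ =>
      hint a e]
    have h2 : ∑ a ∈ A.toLeft, ∫ ω, ∑ e ∈ B.toLeft,
        star ε A (Sum.inl a) (fun i => Z i ω) * star ε B (Sum.inl e) (fun i => Z i ω) ∂μ ≤
        ∑ a ∈ A.toLeft, ∑ e ∈ B.toLeft, L ^ (2 * (r₁ + r₂)) * b ^ ((A ∪ B).card - 1) := by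
      refine Finset.sum_le_sum fun a ha => ?_
      rw [integral_finsetSum _ fun e _ => hint a e]
      exact Finset.sum_le_sum fun e he => hstar a ha e he
    simp only [Finset.sum_const, nsmul_eq_mul, hA₁, hB₁] at h2
    have h3 : ((r₁ : ℝ)⁻¹ * (r₁ : ℝ)⁻¹) * (r₁ * (r₁ * (L ^ (2 * (r₁ + r₂)) *
        b ^ ((A ∪ B).card - 1)))) ≤ L ^ (2 * (r₁ + r₂)) * b ^ ((A ∪ B).card - 1) := by
      have h4 : (r₁ : ℝ)⁻¹ * r₁ ≤ 1 := inv_mul_le_one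
      have h5 : 0 ≤ (r₁ : ℝ)⁻¹ * r₁ := by positivity
      calc _ = ((r₁ : ℝ)⁻¹ * r₁) * ((r₁ : ℝ)⁻¹ * r₁) *
            (L ^ (2 * (r₁ + r₂)) * b ^ ((A ∪ B).card - 1)) := by ring
        _ ≤ 1 * (L ^ (2 * (r₁ + r₂)) * b ^ ((A ∪ B).card - 1)) :=
          mul_le_mul_of_nonneg_right (mul_le_one₀ h4 h5 h4) (by positivity)
        _ = _ := one_mul _
    exact (mul_le_mul_of_nonneg_left h2 (by positivity)).trans h3
  have h6 : ∀ ω, normKernel ε A (fun i => Z i ω) * normKernel ε B (fun i => Z i ω) =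
      (kernel ε A (fun i => Z i ω) * kernel ε B (fun i => Z i ω)) / b ^ (2 * (r₁ + r₂ - 1)) := by
    intro ω
    rw [normKernel, normKernel, hA, hB, div_mul_div_comm, ← pow_add, two_mul]
  simp_rw [h6]
  rw [integral_div, div_le_iff₀ (by positivity), mul_assoc]
  refine hker.trans_eq ?_
  congr 1
  have h7 : 2 * (r₁ + r₂ - 1) = (m - 1) + ((A ∪ B).card - 1) := by omega
  rw [h7, pow_add, ← mul_assoc, ← mul_pow, inv_mul_cancel₀ hb.ne', one_pow, one_mul]

end Kernel

/-! ### Limits as the radius vanishes -/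

section Limits

variable {d : ℕ} {pX pY : Sp d → ℝ} {M : ℝ} {r₁ r₂ : ℕ} {ε : ℕ → ℝ}

/-- The limit of `condMeanX` as `ε → 0`; its variance under `pX` is `ζ_{1,0}`. -/
noncomputable def limitX (r₁ r₂ : ℕ) (pX pY : Sp d → ℝ) (x : Sp d) : ℝ :=
  pX x ^ (r₁ - 1) * pY x ^ r₂

/-- The limit of `condMeanY` as `ε → 0`; its variance under `pY` is `ζ_{0,1}`. -/
noncomputable def limitY (r₁ r₂ : ℕ) (pX pY : Sp d → ℝ) (x : Sp d) : ℝ :=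
  pX x ^ r₁ * pY x ^ (r₂ - 1)

lemma zeta10_eq (hr₁ : 1 ≤ r₁) : zeta10 r₁ r₂ pX pY = Var[limitX r₁ r₂ pX pY; law pX] := by
  obtain ⟨k, rfl⟩ := Nat.exists_eq_add_of_le' hr₁
  unfold zeta10 limitX
  simp

lemma zeta01_eq (hr₂ : 1 ≤ r₂) : zeta01 r₁ r₂ pX pY = Var[limitY r₁ r₂ pX pY; law pY] := by
  obtain ⟨k, rfl⟩ := Nat.exists_eq_add_of_le' hr₂
  unfold zeta01 limitY
  simp

lemma abs_pow_mul_pow_le {a b : ℝ} (ha : |a| ≤ M) (hb : |b| ≤ M) (k l : ℕ) :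
    |a ^ k * b ^ l| ≤ M ^ (k + l) := by
  rw [abs_mul, abs_pow, abs_pow, pow_add]
  have : 0 ≤ M := (abs_nonneg a).trans ha
  gcongr

lemma measurable_limitX (hX : BoundedDensity pX M) (hY : BoundedDensity pY M) :
    Measurable (limitX r₁ r₂ pX pY) :=
  (hX.meas.pow_const _).mul (hY.meas.pow_const _)

lemma measurable_limitY (hX : BoundedDensity pX M) (hY : BoundedDensity pY M) :
    Measurable (limitY r₁ r₂ pX pY) :=
  (hX.meas.pow_const _).mul (hY.meas.pow_const _)

lemma abs_limitX_le (hX : BoundedDensity pX M) (hY : BoundedDensity pY M) (x : Sp d) :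
    |limitX r₁ r₂ pX pY x| ≤ M ^ (r₁ - 1 + r₂) :=
  abs_pow_mul_pow_le (hX.abs_le x) (hY.abs_le x) _ _

lemma abs_limitY_le (hX : BoundedDensity pX M) (hY : BoundedDensity pY M) (x : Sp d) :
    |limitY r₁ r₂ pX pY x| ≤ M ^ (r₁ + (r₂ - 1)) :=
  abs_pow_mul_pow_le (hX.abs_le x) (hY.abs_le x) _ _

lemma integral_limitX (hX : BoundedDensity pX M) (hr₁ : 1 ≤ r₁) :
    ∫ x, limitX r₁ r₂ pX pY x ∂(law pX) = q r₁ r₂ pX pY := by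
  obtain ⟨k, rfl⟩ := Nat.exists_eq_add_of_le' hr₁
  rw [hX.integral_law, q]
  congr with x
  simp only [limitX, Nat.add_sub_cancel]
  ring

lemma integral_limitY (hY : BoundedDensity pY M) (hr₂ : 1 ≤ r₂) :
    ∫ x, limitY r₁ r₂ pX pY x ∂(law pY) = q r₁ r₂ pX pY := by
  obtain ⟨k, rfl⟩ := Nat.exists_eq_add_of_le' hr₂
  rw [hY.integral_law, q]
  congr with x
  simp only [limitY, Nat.add_sub_cancel]
  ring

lemma qTilde_eq (hX : BoundedDensity pX M) (hY : BoundedDensity pY M) (hr₁ : 1 ≤ r₁) {e : ℝ}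
    (he : 0 < e) : qTilde r₁ r₂ pX pY e =
      ∫ x, avg e pX x ^ (r₁ - 1) * avg e pY x ^ r₂ ∂(law pX) := by
  rw [qTilde, qEps, ← integral_div]
  congr with x
  have hb := (ballVol_pos (d := d) he).ne'
  rw [hX.ballProb_eq he, hY.ballProb_eq he, mul_pow, mul_pow,
    show r₁ + r₂ - 1 = (r₁ - 1) + r₂ by omega, pow_add]
  field_simp

lemma abs_qTilde_le (hX : BoundedDensity pX M) (hY : BoundedDensity pY M) (hr₁ : 1 ≤ r₁) {e : ℝ}
    (he : 0 < e) : |qTilde r₁ r₂ pX pY e| ≤ M ^ (r₁ - 1 + r₂) := by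
  have := hX.prob
  rw [qTilde_eq hX hY hr₁ he]
  have h := norm_integral_le_of_norm_le_const (μ := law pX) (f := fun x =>
    avg e pX x ^ (r₁ - 1) * avg e pY x ^ r₂) (C := M ^ (r₁ - 1 + r₂)) (ae_of_all _ fun x =>
    abs_pow_mul_pow_le (abs_avg_le he hX.meas hX.abs_le x) (abs_avg_le he hY.meas hY.abs_le x) _ _)
  simpa using h

lemma tendsto_avg_nhds (hX : BoundedDensity pX M) (hε : ∀ j, 0 < ε j)
    (hε0 : Tendsto ε atTop (𝓝 0)) {x : Sp d} (hx : ContinuousAt pX x) :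
    Tendsto (fun j => avg (ε j) pX x) atTop (𝓝 (pX x)) := by
  have h := (tendsto_avg_shrinking hε hε0 hX.meas hX.abs_le hx).comp (tendsto_diag_shrinking hε x)
  exact h

/-- Asymptotic unbiasedness: `q̃_{r,ε} → q_r`. -/
lemma tendsto_qTilde (hX : BoundedDensity pX M) (hY : BoundedDensity pY M) (hr₁ : 1 ≤ r₁)
    (hε : ∀ j, 0 < ε j) (hε0 : Tendsto ε atTop (𝓝 0)) :
    Tendsto (fun j => qTilde r₁ r₂ pX pY (ε j)) atTop (𝓝 (q r₁ r₂ pX pY)) := by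
  have := hX.prob
  simp_rw [fun j => qTilde_eq (r₂ := r₂) hX hY hr₁ (hε j)]
  rw [← integral_limitX hX hr₁]
  refine tendsto_integral_of_bounded (C := M ^ (r₁ - 1 + r₂))
    (fun j => ((measurable_avg _ hX.meas).pow_const _).mul ((measurable_avg _ hY.meas).pow_const _))
    (fun j x => abs_pow_mul_pow_le (abs_avg_le (hε j) hX.meas hX.abs_le x)
      (abs_avg_le (hε j) hY.meas hY.abs_le x) _ _) ?_
  filter_upwards [ae_law hX.cont, ae_law hY.cont] with x h1 h2
  exact ((tendsto_avg_nhds hX hε hε0 h1).pow _).mul ((tendsto_avg_nhds hY hε hε0 h2).pow _)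

/-- The function whose ball averages occur in `condMeanX` and `condMeanY`: the density of the
centre of a star, weighted by the normalized probabilities that `k + l` other points are near it. -/
noncomputable def starDensity (k l : ℕ) (pX pY : Sp d → ℝ) (e : ℝ) (y : Sp d) : ℝ :=
  avg e pX y ^ k * avg e pY y ^ l * pX y

lemma measurable_starDensity (hX : BoundedDensity pX M) (hY : BoundedDensity pY M) (k l : ℕ)
    (e : ℝ) : Measurable (starDensity k l pX pY e) :=
  (((measurable_avg _ hX.meas).pow_const _).mul ((measurable_avg _ hY.meas).pow_const _)).mul
    hX.meas

lemma abs_starDensity_le (hX : BoundedDensity pX M) (hY : BoundedDensity pY M) (k l : ℕ)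
    {e : ℝ} (he : 0 < e) (x : Sp d) : |starDensity k l pX pY e x| ≤ M ^ (k + l) * M := by
  rw [starDensity, abs_mul]
  have := hX.bound_nonneg
  exact mul_le_mul (abs_pow_mul_pow_le (abs_avg_le he hX.meas hX.abs_le x)
    (abs_avg_le he hY.meas hY.abs_le x) _ _) (hX.abs_le x) (abs_nonneg _) (by positivity)

lemma tendsto_avg_starDensity (hX : BoundedDensity pX M) (hY : BoundedDensity pY M)
    (hε : ∀ j, 0 < ε j) (hε0 : Tendsto ε atTop (𝓝 0)) (k l : ℕ) {x : Sp d}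
    (h1 : ContinuousAt pX x) (h2 : ContinuousAt pY x) :
    Tendsto (fun j => avg (ε j) (starDensity k l pX pY (ε j)) x) atTop
      (𝓝 (pX x ^ k * pY x ^ l * pX x)) := by
  refine tendsto_avg hε (fun j => measurable_starDensity hX hY k l _)
    (fun j => abs_starDensity_le hX hY k l (hε j)) ?_
  exact (((tendsto_avg_shrinking hε hε0 hX.meas hX.abs_le h1).pow k).mul
    ((tendsto_avg_shrinking hε hε0 hY.meas hY.abs_le h2).pow l)).mul
    (h1.tendsto.comp (tendsto_snd_shrinking hε0 x))

lemma condMeanX_eq (e : ℝ) (x : Sp d) : condMeanX r₁ r₂ pX pY e x =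
    (r₁ : ℝ)⁻¹ * (avg e pX x ^ (r₁ - 1) * avg e pY x ^ r₂ +
      ((r₁ : ℝ) - 1) * avg e (starDensity (r₁ - 2) r₂ pX pY e) x) := rfl

lemma measurable_condMeanX (hX : BoundedDensity pX M) (hY : BoundedDensity pY M) (e : ℝ) :
    Measurable (condMeanX r₁ r₂ pX pY e) := by
  have := ((((measurable_avg e hX.meas).pow_const (r₁ - 1)).mul
    ((measurable_avg e hY.meas).pow_const r₂)).add ((measurable_avg e
      (measurable_starDensity hX hY (r₁ - 2) r₂ e)).const_mul ((r₁ : ℝ) - 1))).const_mul (r₁ : ℝ)⁻¹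
  exact this

lemma measurable_condMeanY (hX : BoundedDensity pX M) (hY : BoundedDensity pY M) (e : ℝ) :
    Measurable (condMeanY r₁ r₂ pX pY e) :=
  measurable_avg e (measurable_starDensity hX hY _ _ e)

lemma exists_abs_condMeanX_le (hX : BoundedDensity pX M) (hY : BoundedDensity pY M) :
    ∃ C, ∀ e, 0 < e → ∀ x, |condMeanX r₁ r₂ pX pY e x| ≤ C := by
  refine ⟨|(r₁ : ℝ)⁻¹| * (M ^ (r₁ - 1 + r₂) + |(r₁ : ℝ) - 1| * (M ^ (r₁ - 2 + r₂) * M)),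
    fun e he x => ?_⟩
  rw [condMeanX_eq, abs_mul]
  refine mul_le_mul_of_nonneg_left ((abs_add_le _ _).trans (add_le_add ?_ ?_)) (abs_nonneg _)
  · exact abs_pow_mul_pow_le (abs_avg_le he hX.meas hX.abs_le x)
      (abs_avg_le he hY.meas hY.abs_le x) _ _
  · rw [abs_mul]
    exact mul_le_mul_of_nonneg_left (abs_avg_le he (measurable_starDensity hX hY _ _ _)
      (abs_starDensity_le hX hY _ _ he) x) (abs_nonneg _)

lemma exists_abs_condMeanY_le (hX : BoundedDensity pX M) (hY : BoundedDensity pY M) :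
    ∃ C, ∀ e, 0 < e → ∀ x, |condMeanY r₁ r₂ pX pY e x| ≤ C :=
  ⟨_, fun _ he x => abs_avg_le he (measurable_starDensity hX hY _ _ _)
    (abs_starDensity_le hX hY _ _ he) x⟩

lemma tendsto_condMeanX (hX : BoundedDensity pX M) (hY : BoundedDensity pY M) (hr₁ : 1 ≤ r₁)
    (hε : ∀ j, 0 < ε j) (hε0 : Tendsto ε atTop (𝓝 0)) {x : Sp d}
    (h1 : ContinuousAt pX x) (h2 : ContinuousAt pY x) :
    Tendsto (fun j => condMeanX r₁ r₂ pX pY (ε j) x) atTop (𝓝 (limitX r₁ r₂ pX pY x)) := by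
  have h : limitX r₁ r₂ pX pY x = (r₁ : ℝ)⁻¹ * (pX x ^ (r₁ - 1) * pY x ^ r₂ +
      ((r₁ : ℝ) - 1) * (pX x ^ (r₁ - 2) * pY x ^ r₂ * pX x)) := by
    rcases Nat.lt_or_ge r₁ 2 with hr | hr
    · obtain rfl : r₁ = 1 := by omega
      simp [limitX]
    · obtain ⟨k, rfl⟩ := Nat.exists_eq_add_of_le' hr
      have hk : ((k + 2 : ℕ) : ℝ) ≠ 0 := by positivity
      rw [eq_inv_mul_iff_mul_eq₀ hk, limitX, show k + 2 - 1 = k + 1 by omega, Nat.add_sub_cancel]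
      push_cast
      ring
  rw [h]
  simp_rw [condMeanX_eq]
  exact ((((tendsto_avg_nhds hX hε hε0 h1).pow _).mul ((tendsto_avg_nhds hY hε hε0 h2).pow _)).add
    ((tendsto_avg_starDensity hX hY hε hε0 _ _ h1 h2).const_mul _)).const_mul _

lemma tendsto_condMeanY (hX : BoundedDensity pX M) (hY : BoundedDensity pY M) (hr₁ : 1 ≤ r₁)
    (hε : ∀ j, 0 < ε j) (hε0 : Tendsto ε atTop (𝓝 0)) {x : Sp d}
    (h1 : ContinuousAt pX x) (h2 : ContinuousAt pY x) :
    Tendsto (fun j => condMeanY r₁ r₂ pX pY (ε j) x) atTop (𝓝 (limitY r₁ r₂ pX pY x)) := by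
  have h : limitY r₁ r₂ pX pY x = pX x ^ (r₁ - 1) * pY x ^ (r₂ - 1) * pX x := by
    obtain ⟨k, rfl⟩ := Nat.exists_eq_add_of_le' hr₁
    rw [limitY, Nat.add_sub_cancel]
    ring
  rw [h]
  exact tendsto_avg_starDensity hX hY hε hε0 _ _ h1 h2

/-- If a bounded family `F j` converges almost everywhere to `f` and `c j` to `c`, then
`F j - c j` converges to `f - c` in mean square. -/
lemma tendsto_integral_sq_sub {E : Type*} [MeasurableSpace E] {ν : Measure E}
    [IsProbabilityMeasure ν] {F : ℕ → E → ℝ} {f : E → ℝ} {c : ℕ → ℝ} {c₀ : ℝ} {C : ℝ}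
    (hF : ∀ j, Measurable (F j)) (hf : Measurable f)
    (hFC : ∀ j x, |F j x| ≤ C) (hfC : ∀ x, |f x| ≤ C) (hcC : ∀ j, |c j| ≤ C)
    (hc : Tendsto c atTop (𝓝 c₀))
    (h : ∀ᵐ x ∂ν, Tendsto (fun j => F j x) atTop (𝓝 (f x))) :
    Tendsto (fun j => ∫ x, (F j x - c j - (f x - c₀)) ^ 2 ∂ν) atTop (𝓝 0) := by
  have h0 : (0 : ℝ) = ∫ _, (0 : ℝ) ∂ν := by simp
  rw [h0]
  refine tendsto_integral_of_bounded (C := (C + C + (C + |c₀|)) ^ 2)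
    (fun j => (((hF j).sub_const _).sub (hf.sub_const _)).pow_const _) (fun j x => ?_) ?_
  · rw [abs_pow]
    refine pow_le_pow_left₀ (abs_nonneg _) ((abs_sub _ _).trans (add_le_add ?_ ?_)) 2
    · exact (abs_sub _ _).trans (add_le_add (hFC j x) (hcC j))
    · exact (abs_sub _ _).trans (add_le_add (hfC x) le_rfl)
  · filter_upwards [h] with x hx
    have := ((hx.sub hc).sub_const (f x - c₀)).pow 2
    simpa using this

lemma tendsto_integral_sq_condMeanX_sub (hX : BoundedDensity pX M) (hY : BoundedDensity pY M)
    (hr₁ : 1 ≤ r₁) (hε : ∀ j, 0 < ε j) (hε0 : Tendsto ε atTop (𝓝 0)) :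
    Tendsto (fun j => ∫ x, (condMeanX r₁ r₂ pX pY (ε j) x - qTilde r₁ r₂ pX pY (ε j) -
      (limitX r₁ r₂ pX pY x - q r₁ r₂ pX pY)) ^ 2 ∂(law pX)) atTop (𝓝 0) := by
  have := hX.prob
  obtain ⟨C, hC⟩ := exists_abs_condMeanX_le (r₁ := r₁) (r₂ := r₂) hX hY
  refine tendsto_integral_sq_sub (C := max C (M ^ (r₁ - 1 + r₂)))
    (fun j => measurable_condMeanX hX hY _) (measurable_limitX hX hY)
    (fun j x => (hC _ (hε j) x).trans (le_max_left _ _))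
    (fun x => (abs_limitX_le hX hY x).trans (le_max_right _ _))
    (fun j => (abs_qTilde_le hX hY hr₁ (hε j)).trans (le_max_right _ _))
    (tendsto_qTilde hX hY hr₁ hε hε0) ?_
  filter_upwards [ae_law hX.cont, ae_law hY.cont] with x h1 h2
  exact tendsto_condMeanX hX hY hr₁ hε hε0 h1 h2

lemma tendsto_integral_sq_condMeanY_sub (hX : BoundedDensity pX M) (hY : BoundedDensity pY M)
    (hr₁ : 1 ≤ r₁) (hε : ∀ j, 0 < ε j) (hε0 : Tendsto ε atTop (𝓝 0)) :
    Tendsto (fun j => ∫ x, (condMeanY r₁ r₂ pX pY (ε j) x - qTilde r₁ r₂ pX pY (ε j) -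
      (limitY r₁ r₂ pX pY x - q r₁ r₂ pX pY)) ^ 2 ∂(law pY)) atTop (𝓝 0) := by
  have := hY.prob
  obtain ⟨C, hC⟩ := exists_abs_condMeanY_le (r₁ := r₁) (r₂ := r₂) hX hY
  refine tendsto_integral_sq_sub (C := max C (max (M ^ (r₁ + (r₂ - 1))) (M ^ (r₁ - 1 + r₂))))
    (fun j => measurable_condMeanY hX hY _) (measurable_limitY hX hY)
    (fun j x => (hC _ (hε j) x).trans (le_max_left _ _))
    (fun x => (abs_limitY_le hX hY x).trans ((le_max_left _ _).trans (le_max_right _ _)))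
    (fun j => (abs_qTilde_le hX hY hr₁ (hε j)).trans ((le_max_right _ _).trans (le_max_right _ _)))
    (tendsto_qTilde hX hY hr₁ hε hε0) ?_
  filter_upwards [ae_law hX.cont, ae_law hY.cont] with x h1 h2
  exact tendsto_condMeanY hX hY hr₁ hε hε0 h1 h2

end Limits

/-! ### Mixed moments of centred kernels -/

section SecondMoments

variable {Ω : Type*} [MeasurableSpace Ω] {d : ℕ}

/-- The normalized kernel on the index set `A`, centred at its mean `q̃_{r,ε}` and with an additive
function `∑ ℓ i (z i)` of the sample points subtracted. -/
noncomputable def residual (r₁ r₂ : ℕ) (pX pY : Sp d → ℝ) (ℓ : ℕ ⊕ ℕ → Sp d → ℝ) (ε : ℝ)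
    (A : Finset (ℕ ⊕ ℕ)) (z : ℕ ⊕ ℕ → Sp d) : ℝ :=
  normKernel ε A z - qTilde r₁ r₂ pX pY ε - ∑ i ∈ A, ℓ i (z i)

variable {μ : Measure Ω} {Z : ℕ ⊕ ℕ → Ω → Sp d} {pX pY : Sp d → ℝ}
  {M : ℝ} {r₁ r₂ : ℕ} {A B : Finset (ℕ ⊕ ℕ)} {ℓ : ℕ ⊕ ℕ → Sp d → ℝ} {Cℓ : ℝ}

lemma measurable_residual (hℓ : ∀ i, Measurable (ℓ i)) (ε : ℝ) (A : Finset (ℕ ⊕ ℕ)) :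
    Measurable (residual r₁ r₂ pX pY ℓ ε A) :=
  ((measurable_normKernel ε A).sub_const _).sub
    (Finset.measurable_fun_sum _ fun i _ => (hℓ i).comp (measurable_pi_apply i))

lemma dependsOn_residual (ε : ℝ) (A : Finset (ℕ ⊕ ℕ)) :
    DependsOn (residual r₁ r₂ pX pY ℓ ε A) (A : Set (ℕ ⊕ ℕ)) := by
  intro z w h
  unfold residual
  rw [dependsOn_normKernel ε A h]
  congr 1
  exact Finset.sum_congr rfl fun i hi => by rw [h i hi]

lemma abs_sum_le_card_mul (hℓC : ∀ i x, |ℓ i x| ≤ Cℓ) (A : Finset (ℕ ⊕ ℕ)) (z : ℕ ⊕ ℕ → Sp d) :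
    |∑ i ∈ A, ℓ i (z i)| ≤ A.card * Cℓ := by
  refine (Finset.abs_sum_le_sum_abs _ _).trans ?_
  rw [← nsmul_eq_mul]
  exact Finset.sum_le_card_nsmul _ _ _ fun i _ => hℓC i _

lemma abs_residual_le (hs : IndepSample μ Z (jointDensity pX pY) M) (hr₁ : 1 ≤ r₁)
    (hℓC : ∀ i x, |ℓ i x| ≤ Cℓ) {ε : ℝ} (hε : 0 < ε) (A : Finset (ℕ ⊕ ℕ)) (z : ℕ ⊕ ℕ → Sp d) :
    |residual r₁ r₂ pX pY ℓ ε A z| ≤ normKernel ε A z + (M ^ (r₁ - 1 + r₂) + A.card * Cℓ) := by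
  have h1 := abs_sub (normKernel ε A z - qTilde r₁ r₂ pX pY ε) (∑ i ∈ A, ℓ i (z i))
  have h2 := abs_sub (normKernel ε A z) (qTilde r₁ r₂ pX pY ε)
  rw [abs_of_nonneg (normKernel_nonneg ε A z)] at h2
  have h3 := abs_qTilde_le (r₂ := r₂) hs.densityX hs.densityY hr₁ hε
  have h4 := abs_sum_le_card_mul hℓC A z
  unfold residual
  linarith

lemma exists_abs_residual_le (hs : IndepSample μ Z (jointDensity pX pY) M) (hr₁ : 1 ≤ r₁)
    (hℓC : ∀ i x, |ℓ i x| ≤ Cℓ) {ε : ℝ} (hε : 0 < ε) (A : Finset (ℕ ⊕ ℕ)) :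
    ∃ C, ∀ z, |residual r₁ r₂ pX pY ℓ ε A z| ≤ C :=
  ⟨_, fun z => (abs_residual_le hs hr₁ hℓC hε A z).trans
    (add_le_add ((le_abs_self _).trans (abs_normKernel_le ε A z)) le_rfl)⟩

variable [IsProbabilityMeasure μ]

lemma integrable_residual_mul (hs : IndepSample μ Z (jointDensity pX pY) M) (hr₁ : 1 ≤ r₁)
    (hℓ : ∀ i, Measurable (ℓ i)) (hℓC : ∀ i x, |ℓ i x| ≤ Cℓ) {ε : ℝ} (hε : 0 < ε)
    (A B : Finset (ℕ ⊕ ℕ)) :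
    Integrable (fun ω => residual r₁ r₂ pX pY ℓ ε A (fun i => Z i ω) *
      residual r₁ r₂ pX pY ℓ ε B (fun i => Z i ω)) μ := by
  obtain ⟨C, hC⟩ := exists_abs_residual_le (r₂ := r₂) hs hr₁ hℓC hε A
  obtain ⟨C', hC'⟩ := exists_abs_residual_le (r₂ := r₂) hs hr₁ hℓC hε B
  refine hs.integrable_of_bounded (F := fun z => residual r₁ r₂ pX pY ℓ ε A z *
    residual r₁ r₂ pX pY ℓ ε B z) ((measurable_residual hℓ ε A).mul (measurable_residual hℓ ε B))
    (C := C * C') fun z => ?_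
  rw [abs_mul]
  exact mul_le_mul (hC z) (hC' z) (abs_nonneg _) ((abs_nonneg _).trans (hC z))

lemma integrable_normKernel (hs : IndepSample μ Z (jointDensity pX pY) M) (ε : ℝ)
    (A : Finset (ℕ ⊕ ℕ)) : Integrable (fun ω => normKernel ε A (fun i => Z i ω)) μ :=
  hs.integrable_of_bounded (measurable_normKernel ε A) (abs_normKernel_le ε A)

lemma integral_residual (hs : IndepSample μ Z (jointDensity pX pY) M) (hr₁ : 1 ≤ r₁)
    (hℓ : ∀ i, Measurable (ℓ i)) (hℓC : ∀ i x, |ℓ i x| ≤ Cℓ) (ε : ℝ)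
    (hℓ0 : ∀ i ∈ A, ∫ x, ℓ i x ∂(law (jointDensity pX pY i)) = 0)
    (hA₁ : A.toLeft.card = r₁) (hA₂ : A.toRight.card = r₂) :
    ∫ ω, residual r₁ r₂ pX pY ℓ ε A (fun i => Z i ω) ∂μ = 0 := by
  have h1 : ∀ i, Integrable (fun ω => ℓ i (Z i ω)) μ := fun i =>
    hs.integrable_of_bounded (F := fun z => ℓ i (z i)) ((hℓ i).comp (measurable_pi_apply i))
      fun z => hℓC i _
  have h2 : Integrable (fun ω => normKernel ε A (fun i => Z i ω) - qTilde r₁ r₂ pX pY ε) μ :=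
    (integrable_normKernel hs ε A).sub (integrable_const _)
  simp only [residual]
  rw [integral_sub h2 (integrable_finsetSum _ fun i _ => h1 i),
    integral_sub (integrable_normKernel hs ε A) (integrable_const _),
    integral_normKernel hs ε hr₁ hA₁ hA₂, integral_finsetSum _ fun i _ => h1 i,
    Finset.sum_eq_zero fun i hi => ?_]
  · simp
  · rw [← hℓ0 i hi, ← hs.map_eq,
      integral_map (hs.meas i).aemeasurable (hℓ i).aestronglyMeasurable]

lemma integral_residual_mul_of_disjoint (hs : IndepSample μ Z (jointDensity pX pY) M)
    (hr₁ : 1 ≤ r₁) (hℓ : ∀ i, Measurable (ℓ i)) (hℓC : ∀ i x, |ℓ i x| ≤ Cℓ) (ε : ℝ)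
    (hℓ0 : ∀ i ∈ A, ∫ x, ℓ i x ∂(law (jointDensity pX pY i)) = 0)
    (hA₁ : A.toLeft.card = r₁) (hA₂ : A.toRight.card = r₂) (hAB : Disjoint A B) :
    ∫ ω, residual r₁ r₂ pX pY ℓ ε A (fun i => Z i ω) *
      residual r₁ r₂ pX pY ℓ ε B (fun i => Z i ω) ∂μ = 0 := by
  rw [IndepFun.integral_fun_mul_eq_mul_integral
    (indepFun_of_dependsOn hs.indep hs.meas (measurable_residual hℓ ε A)
      (measurable_residual hℓ ε B) (dependsOn_residual ε A) (dependsOn_residual ε B) hAB)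
    ((measurable_residual hℓ ε A).comp hs.measurable_pi).aestronglyMeasurable
    ((measurable_residual hℓ ε B).comp hs.measurable_pi).aestronglyMeasurable,
    integral_residual hs hr₁ hℓ hℓC ε hℓ0 hA₁ hA₂, zero_mul]

/-- The mean of the residual when the sample point `c` is fixed. -/
lemma integral_residual_update (hs : IndepSample μ Z (jointDensity pX pY) M)
    (hℓ : ∀ i, Measurable (ℓ i)) (hℓC : ∀ i x, |ℓ i x| ≤ Cℓ) (ε : ℝ)
    (hℓ0 : ∀ i ∈ A, ∫ x, ℓ i x ∂(law (jointDensity pX pY i)) = 0) {c : ℕ ⊕ ℕ} (hc : c ∈ A)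
    (x : Sp d) :
    ∫ ω, residual r₁ r₂ pX pY ℓ ε A (Function.update (fun i => Z i ω) c x) ∂μ =
      (∫ ω, normKernel ε A (Function.update (fun i => Z i ω) c x) ∂μ) -
        qTilde r₁ r₂ pX pY ε - ℓ c x := by
  have hK : Integrable (fun ω => normKernel ε A (Function.update (fun i => Z i ω) c x)) μ :=
    hs.integrable_of_bounded (F := fun z => normKernel ε A (Function.update z c x))
      ((measurable_normKernel ε A).comp measurable_update_left) fun z => abs_normKernel_le ε A _
  have h1 : ∀ i, Integrable (fun ω => ℓ i (Function.update (fun i => Z i ω) c x i)) μ := fun i =>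
    hs.integrable_of_bounded (F := fun z => ℓ i (Function.update z c x i))
      ((hℓ i).comp ((measurable_pi_apply i).comp measurable_update_left)) fun z => hℓC i _
  have h2 : Integrable (fun ω => normKernel ε A (Function.update (fun i => Z i ω) c x) -
      qTilde r₁ r₂ pX pY ε) μ := hK.sub (integrable_const _)
  simp only [residual]
  rw [integral_sub h2 (integrable_finsetSum _ fun i _ => h1 i),
    integral_sub hK (integrable_const _), integral_finsetSum _ fun i _ => h1 i,
    ← Finset.add_sum_erase _ _ hc, Finset.sum_eq_zero fun i hi => ?_]
  · simp
  · rw [← hℓ0 i (Finset.mem_of_mem_erase hi), ← hs.map_eq,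
      integral_map (hs.meas i).aemeasurable (hℓ i).aestronglyMeasurable]
    simp [Finset.ne_of_mem_erase hi]

lemma integral_residual_mul_of_inter_eq_singleton (hs : IndepSample μ Z (jointDensity pX pY) M)
    (hr₁ : 1 ≤ r₁) (hℓ : ∀ i, Measurable (ℓ i)) (hℓC : ∀ i x, |ℓ i x| ≤ Cℓ) {ε : ℝ} (hε : 0 < ε)
    (hℓA : ∀ i ∈ A, ∫ x, ℓ i x ∂(law (jointDensity pX pY i)) = 0)
    (hℓB : ∀ i ∈ B, ∫ x, ℓ i x ∂(law (jointDensity pX pY i)) = 0)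
    {c : ℕ ⊕ ℕ} (hAB : A ∩ B = {c}) {m : Sp d → ℝ}
    (hA : ∀ x, ∫ ω, normKernel ε A (Function.update (fun i => Z i ω) c x) ∂μ = m x)
    (hB : ∀ x, ∫ ω, normKernel ε B (Function.update (fun i => Z i ω) c x) ∂μ = m x) :
    ∫ ω, residual r₁ r₂ pX pY ℓ ε A (fun i => Z i ω) *
      residual r₁ r₂ pX pY ℓ ε B (fun i => Z i ω) ∂μ =
      ∫ x, (m x - qTilde r₁ r₂ pX pY ε - ℓ c x) ^ 2 ∂(law (jointDensity pX pY c)) := by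
  have hc : c ∈ A ∩ B := by simp [hAB]
  obtain ⟨C, hC⟩ := exists_abs_residual_le (r₂ := r₂) hs hr₁ hℓC hε A
  obtain ⟨C', hC'⟩ := exists_abs_residual_le (r₂ := r₂) hs hr₁ hℓC hε B
  rw [integral_mul_eq_integral_update hs.indep hs.meas c (measurable_residual hℓ ε A)
    (measurable_residual hℓ ε B) (dependsOn_residual ε A) (dependsOn_residual ε B)
    hAB.le (C := max C C') (fun z => (hC z).trans (le_max_left _ _))
    (fun z => (hC' z).trans (le_max_right _ _)), hs.map_eq]
  congr with x
  rw [integral_residual_update hs hℓ hℓC ε hℓA (Finset.mem_inter.1 hc).1,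
    integral_residual_update hs hℓ hℓC ε hℓB (Finset.mem_inter.1 hc).2, hA, hB, sq]

/-- A bound for the mixed moments of overlapping residuals, uniform in the radius and in the
index sets. -/
lemma exists_integral_residual_mul_le (hs : IndepSample μ Z (jointDensity pX pY) M)
    (hr₁ : 1 ≤ r₁) (hℓ : ∀ i, Measurable (ℓ i)) (hℓC : ∀ i x, |ℓ i x| ≤ Cℓ) :
    ∃ K, 0 ≤ K ∧ ∀ ε, 0 < ε → ballVol d ε ≤ 1 → ∀ A B : Finset (ℕ ⊕ ℕ),
      A.toLeft.card = r₁ → A.toRight.card = r₂ → B.toLeft.card = r₁ → B.toRight.card = r₂ →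
      1 ≤ (A ∩ B).card →
      ∫ ω, residual r₁ r₂ pX pY ℓ ε A (fun i => Z i ω) *
        residual r₁ r₂ pX pY ℓ ε B (fun i => Z i ω) ∂μ ≤
          K * ((ballVol d ε)⁻¹) ^ ((A ∩ B).card - 1) := by
  have hM := hs.densityX.bound_nonneg
  have hCℓ : 0 ≤ Cℓ := (abs_nonneg _).trans (hℓC (Sum.inl 0) 0)
  set q₀ : ℝ := M ^ (r₁ - 1 + r₂) with hq₀
  have hq₀' : 0 ≤ q₀ := pow_nonneg hM _
  set C : ℝ := q₀ + (r₁ + r₂ : ℕ) * Cℓ with hC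
  have hC0 : 0 ≤ C := by positivity
  refine ⟨(max 1 (2 ^ d * M)) ^ (2 * (r₁ + r₂)) + (C * q₀ + C * q₀ + C * C), by positivity, ?_⟩
  intro ε hε hb A B hA₁ hA₂ hB₁ hB₂ hAB
  have hbpos := ballVol_pos (d := d) hε
  have hA := card_eq_of_card_eq hA₁ hA₂
  have hB := card_eq_of_card_eq hB₁ hB₂
  have iA := integrable_normKernel hs ε A
  have iB := integrable_normKernel hs ε B
  have iAB : Integrable (fun ω => normKernel ε A (fun i => Z i ω) *
      normKernel ε B (fun i => Z i ω)) μ :=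
    hs.integrable_of_bounded (F := fun z => normKernel ε A z * normKernel ε B z)
      ((measurable_normKernel ε A).mul (measurable_normKernel ε B)) fun z => by
        rw [abs_mul]
        exact mul_le_mul (abs_normKernel_le ε A z) (abs_normKernel_le ε B z) (abs_nonneg _)
          ((abs_nonneg _).trans (abs_normKernel_le ε A z))
  have iS : Integrable (fun ω => C * normKernel ε A (fun i => Z i ω) +
      C * normKernel ε B (fun i => Z i ω)) μ := (iA.const_mul C).add (iB.const_mul C)
  have iT : Integrable (fun ω => C * normKernel ε A (fun i => Z i ω) +
      C * normKernel ε B (fun i => Z i ω) + C * C) μ := iS.add (integrable_const _)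
  have hq : qTilde r₁ r₂ pX pY ε ≤ q₀ :=
    (le_abs_self _).trans (abs_qTilde_le hs.densityX hs.densityY hr₁ hε)
  have h1 : ∫ ω, residual r₁ r₂ pX pY ℓ ε A (fun i => Z i ω) *
        residual r₁ r₂ pX pY ℓ ε B (fun i => Z i ω) ∂μ ≤
      ∫ ω, (normKernel ε A (fun i => Z i ω) * normKernel ε B (fun i => Z i ω) +
        (C * normKernel ε A (fun i => Z i ω) + C * normKernel ε B (fun i => Z i ω) +
          C * C)) ∂μ := by
    refine integral_mono (integrable_residual_mul hs hr₁ hℓ hℓC hε A B)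
      (iAB.add iT) fun ω => ?_
    have e1 := abs_residual_le (r₂ := r₂) hs hr₁ hℓC hε A fun i => Z i ω
    have e2 := abs_residual_le (r₂ := r₂) hs hr₁ hℓC hε B fun i => Z i ω
    rw [hA] at e1
    rw [hB] at e2
    have e3 := mul_le_mul e1 e2 (abs_nonneg _) ((abs_nonneg _).trans e1)
    rw [← abs_mul] at e3
    refine (le_abs_self _).trans (e3.trans_eq ?_)
    ring
  rw [integral_add iAB iT, integral_add iS (integrable_const _),
    integral_add (iA.const_mul C) (iB.const_mul C), integral_const_mul, integral_const_mul,
    integral_normKernel hs ε hr₁ hA₁ hA₂, integral_normKernel hs ε hr₁ hB₁ hB₂] at h1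
  simp only [integral_const, probReal_univ, one_smul] at h1
  have h2 := integral_normKernel_mul_le hs hε hA₁ hA₂ hB₁ hB₂ hAB
  have h3 : 1 ≤ ((ballVol d ε)⁻¹) ^ ((A ∩ B).card - 1) := one_le_pow₀ ((one_le_inv₀ hbpos).2 hb)
  have h4 : C * qTilde r₁ r₂ pX pY ε ≤ C * q₀ := mul_le_mul_of_nonneg_left hq hC0
  have h5 : C * q₀ + C * q₀ + C * C ≤
      (C * q₀ + C * q₀ + C * C) * ((ballVol d ε)⁻¹) ^ ((A ∩ B).card - 1) :=
    le_mul_of_one_le_right (by positivity) h3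
  rw [add_mul]
  linarith

end SecondMoments

/-! ### The estimator as an average of kernels -/

section Averages

lemma sum_powersetCard_sum {α : Type*} [DecidableEq α] (t : Finset α) (r : ℕ) (g : α → ℝ) :
    ∑ S ∈ t.powersetCard r, ∑ i ∈ S, g i =
      (t.card.choose r : ℝ) * ((r / t.card : ℝ) * ∑ i ∈ t, g i) := by
  rcases Nat.eq_zero_or_pos r with rfl | hr
  · simp
  rcases t.eq_empty_or_nonempty with rfl | ht
  · have h : (∅ : Finset α).powersetCard r = ∅ := by
      rw [Finset.powersetCard_eq_empty]; simpa using hr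
    simp [h]
  have hcard : (0 : ℝ) < t.card := by exact_mod_cast ht.card_pos
  have h1 : ∀ S ∈ t.powersetCard r, ∑ i ∈ S, g i = ∑ i ∈ t, if {i} ⊆ S then g i else 0 := by
    intro S hS
    simp only [Finset.singleton_subset_iff]
    rw [Finset.sum_ite_mem, Finset.inter_eq_right.2 (Finset.mem_powersetCard.1 hS).1]
  rw [Finset.sum_congr rfl h1, Finset.sum_comm, Finset.mul_sum, Finset.mul_sum]
  refine Finset.sum_congr rfl fun i hi => ?_
  rw [← Finset.sum_filter, Finset.sum_const, nsmul_eq_mul,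
    Finset.card_filter_powersetCard_subset {i} t r (by simpa using hi)
      (by rwa [Finset.card_singleton]),
    Finset.card_singleton]
  have h2 : t.card * (t.card - 1).choose (r - 1) = t.card.choose r * r := by
    obtain ⟨k, rfl⟩ := Nat.exists_eq_add_of_le' hr
    obtain ⟨l, hl⟩ := Nat.exists_eq_add_of_le' ht.card_pos
    rw [hl]
    exact Nat.add_one_mul_choose_eq l k
  have h3 : (t.card : ℝ) * ((t.card - 1).choose (r - 1) : ℝ) = t.card.choose r * r := by
    exact_mod_cast h2
  field_simp
  linear_combination g i * h3

/-- Averaging an additive function over all pairs of subsamples. -/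
lemma average_samplePairs_sum {r₁ r₂ n₁ n₂ : ℕ} (h₁ : r₁ ≤ n₁) (h₂ : r₂ ≤ n₂)
    (g : ℕ ⊕ ℕ → ℝ) :
    ((samplePairs r₁ r₂ n₁ n₂).card : ℝ)⁻¹ *
      ∑ s ∈ samplePairs r₁ r₂ n₁ n₂, ∑ i ∈ s.1.disjSum s.2, g i =
      (r₁ / n₁ : ℝ) * ∑ i ∈ Finset.range n₁, g (Sum.inl i) +
        (r₂ / n₂ : ℝ) * ∑ k ∈ Finset.range n₂, g (Sum.inr k) := by
  have c₁ : (n₁.choose r₁ : ℝ) ≠ 0 := by exact_mod_cast (Nat.choose_pos h₁).ne'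
  have c₂ : (n₂.choose r₂ : ℝ) ≠ 0 := by exact_mod_cast (Nat.choose_pos h₂).ne'
  rw [card_samplePairs, samplePairs, Finset.sum_product]
  simp_rw [Finset.sum_disjSum, Finset.sum_add_distrib, Finset.sum_const, Finset.card_powersetCard,
    Finset.card_range, nsmul_eq_mul]
  rw [← Finset.mul_sum, sum_powersetCard_sum, sum_powersetCard_sum, Finset.card_range,
    Finset.card_range, Nat.cast_mul, mul_inv]
  generalize (r₁ / n₁ : ℝ) * _ = a
  generalize (r₂ / n₂ : ℝ) * _ = b
  field_simp

variable {Ω : Type*} {d : ℕ} {Z : ℕ ⊕ ℕ → Ω → Sp d} {pX pY : Sp d → ℝ}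
  {M : ℝ} {r₁ r₂ n₁ n₂ : ℕ} {ℓ : ℕ ⊕ ℕ → Sp d → ℝ} {Cℓ : ℝ} {ε : ℝ}

/-- The estimator as a function of the joint sample. -/
noncomputable def estimator (Z : ℕ ⊕ ℕ → Ω → Sp d) (r₁ r₂ n₁ n₂ : ℕ) (ε : ℝ) (ω : Ω) : ℝ :=
  UTilde r₁ r₂ n₁ n₂ ε (fun i => Z (Sum.inl i) ω) fun i => Z (Sum.inr i) ω

lemma estimator_eq (hε : 0 < ε) (r₁ r₂ n₁ n₂ : ℕ) (ω : Ω) :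
    estimator Z r₁ r₂ n₁ n₂ ε ω = ((samplePairs r₁ r₂ n₁ n₂).card : ℝ)⁻¹ *
      ∑ s ∈ samplePairs r₁ r₂ n₁ n₂, normKernel ε (s.1.disjSum s.2) (fun i => Z i ω) := by
  rw [estimator, UTilde_eq_average hε]
  have : Sum.elim (fun i => Z (Sum.inl i) ω) (fun i => Z (Sum.inr i) ω) = fun i => Z i ω := by
    ext i; cases i <;> rfl
  rw [this]

lemma samplePairs_card_ne_zero (h₁ : r₁ ≤ n₁) (h₂ : r₂ ≤ n₂) :
    ((samplePairs r₁ r₂ n₁ n₂).card : ℝ) ≠ 0 := by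
  rw [card_samplePairs]
  exact_mod_cast (Nat.mul_pos (Nat.choose_pos h₁) (Nat.choose_pos h₂)).ne'

lemma estimator_sub_eq_average_residual (hε : 0 < ε) (h₁ : r₁ ≤ n₁) (h₂ : r₂ ≤ n₂) (ω : Ω) :
    estimator Z r₁ r₂ n₁ n₂ ε ω - qTilde r₁ r₂ pX pY ε -
      ((r₁ / n₁ : ℝ) * ∑ i ∈ Finset.range n₁, ℓ (Sum.inl i) (Z (Sum.inl i) ω) +
        (r₂ / n₂ : ℝ) * ∑ k ∈ Finset.range n₂, ℓ (Sum.inr k) (Z (Sum.inr k) ω)) =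
    ((samplePairs r₁ r₂ n₁ n₂).card : ℝ)⁻¹ * ∑ s ∈ samplePairs r₁ r₂ n₁ n₂,
      residual r₁ r₂ pX pY ℓ ε (s.1.disjSum s.2) (fun i => Z i ω) := by
  have hN := samplePairs_card_ne_zero h₁ h₂
  rw [← average_samplePairs_sum h₁ h₂ fun i => ℓ i (Z i ω), estimator_eq hε]
  simp only [residual, Finset.sum_sub_distrib, Finset.sum_const, nsmul_eq_mul]
  field_simp

variable [MeasurableSpace Ω] {μ : Measure Ω}

lemma measurable_estimator (hs : IndepSample μ Z (jointDensity pX pY) M) (hε : 0 < ε)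
    (r₁ r₂ n₁ n₂ : ℕ) : Measurable (estimator Z r₁ r₂ n₁ n₂ ε) := by
  have h : estimator Z r₁ r₂ n₁ n₂ ε = _ := funext fun ω => estimator_eq hε r₁ r₂ n₁ n₂ ω
  rw [h]
  exact (Finset.measurable_fun_sum _ fun s _ =>
    (measurable_normKernel ε _).comp hs.measurable_pi).const_mul _

variable [IsProbabilityMeasure μ]

lemma integral_estimator (hs : IndepSample μ Z (jointDensity pX pY) M) (hr₁ : 1 ≤ r₁)
    (hε : 0 < ε) (h₁ : r₁ ≤ n₁) (h₂ : r₂ ≤ n₂) :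
    ∫ ω, estimator Z r₁ r₂ n₁ n₂ ε ω ∂μ = qTilde r₁ r₂ pX pY ε := by
  have hN := samplePairs_card_ne_zero h₁ h₂
  simp_rw [estimator_eq hε]
  rw [integral_const_mul, integral_finsetSum _ fun s _ => integrable_normKernel hs ε _,
    Finset.sum_congr rfl fun s hs' => integral_normKernel hs ε hr₁ (r₂ := r₂)
      (by rw [Finset.toLeft_disjSum]; exact (mem_samplePairs.1 hs').1.2)
      (by rw [Finset.toRight_disjSum]; exact (mem_samplePairs.1 hs').2.2),
    Finset.sum_const, nsmul_eq_mul, inv_mul_cancel_left₀ hN]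

/-- The mean square of the estimator, after subtraction of its mean and of an additive statistic,
in terms of bounds `v m` for the mixed moments of residuals with overlap `m`. -/
lemma integral_sq_estimator_sub_le (hs : IndepSample μ Z (jointDensity pX pY) M) (hr₁ : 1 ≤ r₁)
    (hℓ : ∀ i, Measurable (ℓ i)) (hℓC : ∀ i x, |ℓ i x| ≤ Cℓ)
    (hℓ0 : ∀ A : Finset (ℕ ⊕ ℕ), A.toRight.card = r₂ → ∀ i ∈ A,
      ∫ x, ℓ i x ∂(law (jointDensity pX pY i)) = 0)
    (hε : 0 < ε) (h₁ : r₁ ≤ n₁) (h₂ : r₂ ≤ n₂) {v : ℕ → ℝ} (hv : ∀ m, 0 ≤ v m)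
    (hv' : ∀ A B : Finset (ℕ ⊕ ℕ), A.toLeft.card = r₁ → A.toRight.card = r₂ →
      B.toLeft.card = r₁ → B.toRight.card = r₂ → 1 ≤ (A ∩ B).card →
      ∫ ω, residual r₁ r₂ pX pY ℓ ε A (fun i => Z i ω) *
        residual r₁ r₂ pX pY ℓ ε B (fun i => Z i ω) ∂μ ≤ v (A ∩ B).card) :
    ∫ ω, (estimator Z r₁ r₂ n₁ n₂ ε ω - qTilde r₁ r₂ pX pY ε -
      ((r₁ / n₁ : ℝ) * ∑ i ∈ Finset.range n₁, ℓ (Sum.inl i) (Z (Sum.inl i) ω) +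
        (r₂ / n₂ : ℝ) * ∑ k ∈ Finset.range n₂, ℓ (Sum.inr k) (Z (Sum.inr k) ω))) ^ 2 ∂μ ≤
      ∑ m ∈ Finset.range (r₁ + r₂ + 1),
        ((r₁ + r₂).choose m : ℝ) * (v m * (r₁ / n₁ + r₂ / n₂ : ℝ) ^ m) := by
  simp_rw [estimator_sub_eq_average_residual hε h₁ h₂]
  have hN := samplePairs_card_ne_zero h₁ h₂
  have hc : ∀ s ∈ samplePairs r₁ r₂ n₁ n₂, (s.1.disjSum s.2).toLeft.card = r₁ ∧
      (s.1.disjSum s.2).toRight.card = r₂ := fun s hs' => by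
    rw [Finset.toLeft_disjSum, Finset.toRight_disjSum]
    exact ⟨(mem_samplePairs.1 hs').1.2, (mem_samplePairs.1 hs').2.2⟩
  refine integral_sq_average_le (samplePairs r₁ r₂ n₁ n₂) (fun s => s.1.disjSum s.2) _
    (Finset.card_ne_zero.1 (by exact_mod_cast hN))
    (fun s hs' => card_eq_of_card_eq (hc s hs').1 (hc s hs').2)
    (card_samplePairs_filter_le h₁ h₂) hv
    (fun s _ t _ => integrable_residual_mul hs hr₁ hℓ hℓC hε _ _) fun s hs' t ht' => ?_
  obtain ⟨a1, a2⟩ := hc s hs'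
  obtain ⟨b1, b2⟩ := hc t ht'
  rcases Nat.eq_zero_or_pos (s.1.disjSum s.2 ∩ t.1.disjSum t.2).card with h0 | h0
  · rw [integral_residual_mul_of_disjoint hs hr₁ hℓ hℓC ε (hℓ0 _ a2) a1 a2
      (Finset.disjoint_iff_inter_eq_empty.2 (Finset.card_eq_zero.1 h0))]
    exact hv _
  · exact hv' _ _ a1 a2 b1 b2 h0

/-- The variance of the estimator is bounded by a sum over the possible overlaps of two
subsamples. -/
lemma exists_integral_sq_estimator_sub_le (hs : IndepSample μ Z (jointDensity pX pY) M)
    (hr₁ : 1 ≤ r₁) (r₂ : ℕ) : ∃ K, 0 ≤ K ∧ ∀ (n₁ n₂ : ℕ) (ε : ℝ), 0 < ε → ballVol d ε ≤ 1 →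
      r₁ ≤ n₁ → r₂ ≤ n₂ →
      ∫ ω, (estimator Z r₁ r₂ n₁ n₂ ε ω - qTilde r₁ r₂ pX pY ε) ^ 2 ∂μ ≤
      ∑ m ∈ Finset.range (r₁ + r₂ + 1), ((r₁ + r₂).choose m : ℝ) *
        ((if m = 0 then 0 else K * ((ballVol d ε)⁻¹) ^ (m - 1)) *
          (r₁ / n₁ + r₂ / n₂ : ℝ) ^ m) := by
  obtain ⟨K, hK, h⟩ := exists_integral_residual_mul_le (r₂ := r₂) (ℓ := fun _ _ => 0) (Cℓ := 0)
    hs hr₁ (fun _ => measurable_const) (by simp)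
  refine ⟨K, hK, fun n₁ n₂ ε hε hb h₁ h₂ => ?_⟩
  have hbn := ballVol_nonneg (d := d) ε
  have := integral_sq_estimator_sub_le (ℓ := fun _ _ => 0) (Cℓ := 0) (ε := ε)
    (v := fun m => if m = 0 then 0 else K * ((ballVol d ε)⁻¹) ^ (m - 1)) hs hr₁
    (fun _ => measurable_const) (by simp) (by simp) hε h₁ h₂
    (fun m => by split_ifs <;> positivity)
    (fun A B a1 a2 b1 b2 h0 => by
      rw [if_neg (by omega)]
      exact h ε hε hb A B a1 a2 b1 b2 h0)
  simpa using this

end Averages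

/-! ### Mean square rates -/

section Rates

/-- If `n ε^{d(1-1/r)}` is at least `c`, then every overlap `m ≤ r` contributes at most the order
`n⁻¹ ε^{d(1/r-1)}` to the variance. -/
lemma overlap_term_le {d r m : ℕ} (hm : 1 ≤ m) (hmr : m ≤ r) {n ε c : ℝ}
    (hε : 0 < ε) (hε1 : ε ≤ 1) (hc : 0 < c) (h : c ≤ n * ε ^ ((d : ℝ) * (1 - 1 / r))) :
    ((n * ε ^ d)⁻¹) ^ (m - 1) ≤ (c⁻¹) ^ (m - 1) * ε ^ ((d : ℝ) * (1 / r - 1)) := by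
  have hr : (0 : ℝ) < r := by exact_mod_cast (by omega : 0 < r)
  -- rewrite `n * ε ^ d = (n * ε ^ (d * (1 - 1 / r))) * ε ^ (d / r)`
  have h1 : n * ε ^ d = (n * ε ^ ((d : ℝ) * (1 - 1 / r))) * ε ^ ((d : ℝ) / r) := by
    rw [mul_assoc, ← Real.rpow_add hε, ← Real.rpow_natCast]
    congr 2
    field_simp
    ring
  have hpos : 0 < ε ^ ((d : ℝ) / r) := Real.rpow_pos_of_pos hε _
  rw [h1, mul_inv, mul_pow]
  refine mul_le_mul ?_ ?_ (by positivity) (by positivity)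
  · exact pow_le_pow_left₀ (inv_nonneg.2 (hc.le.trans h)) (inv_anti₀ hc h) _
  · rw [← Real.rpow_neg hε.le, ← Real.rpow_natCast, ← Real.rpow_mul hε.le]
    refine Real.rpow_le_rpow_of_exponent_ge hε hε1 ?_
    have h2 : ((m - 1 : ℕ) : ℝ) ≤ r - 1 := by
      rw [Nat.cast_sub hm, Nat.cast_one]
      have : (m : ℝ) ≤ r := by exact_mod_cast hmr
      linarith
    have h3 : (d : ℝ) * (1 / r - 1) = -((d : ℝ) / r) * (r - 1) := by
      field_simp
      ring
    rw [h3]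
    have h4 : 0 ≤ (d : ℝ) / r := by positivity
    nlinarith

/-- The overlap frequency of two subsamples has order `1 / n`. -/
lemma exists_eventually_overlap_le {n₁ n₂ : ℕ → ℕ} {p : ℝ} (r₁ r₂ : ℕ)
    (hn₁ : Tendsto n₁ atTop atTop) (hp₀ : 0 < p) (hp₁ : p < 1)
    (hp : Tendsto (fun j => (n₁ j : ℝ) / ((n₁ j : ℝ) + (n₂ j : ℝ))) atTop (𝓝 p)) :
    ∃ R, 0 < R ∧ ∀ᶠ j in atTop, (r₁ / n₁ j + r₂ / n₂ j : ℝ) ≤ R * ((n₁ j : ℝ) + n₂ j)⁻¹ := by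
  refine ⟨r₁ * (2 / p) + r₂ * (2 / (1 - p)) + 1, ?_, ?_⟩
  · have : 0 < 1 - p := by linarith
    positivity
  filter_upwards [hp.eventually (lt_mem_nhds (half_lt_self hp₀)),
    hp.eventually (gt_mem_nhds (show p < (1 + p) / 2 by linarith)),
    hn₁.eventually_ge_atTop 1] with j h1 h2 h3
  have hn1 : (0 : ℝ) < n₁ j := by exact_mod_cast h3
  have hn2 : (0 : ℝ) ≤ n₂ j := Nat.cast_nonneg _
  have hn : 0 < (n₁ j : ℝ) + n₂ j := by positivity
  have hp1 : 0 < 1 - p := by linarith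
  rw [lt_div_iff₀ hn] at h1
  rw [div_lt_iff₀ hn] at h2
  have hn2' : 0 < (n₂ j : ℝ) := by nlinarith
  have e1 : (1 : ℝ) / n₁ j ≤ 2 / p * ((n₁ j : ℝ) + n₂ j)⁻¹ := by
    rw [← div_eq_mul_inv, div_div, div_le_div_iff₀ hn1 (by positivity)]
    nlinarith
  have e2 : (1 : ℝ) / n₂ j ≤ 2 / (1 - p) * ((n₁ j : ℝ) + n₂ j)⁻¹ := by
    rw [← div_eq_mul_inv, div_div, div_le_div_iff₀ hn2' (by positivity)]
    nlinarith
  calc (r₁ / n₁ j + r₂ / n₂ j : ℝ) = r₁ * (1 / n₁ j) + r₂ * (1 / n₂ j) := by ring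
    _ ≤ r₁ * (2 / p * ((n₁ j : ℝ) + n₂ j)⁻¹) + r₂ * (2 / (1 - p) * ((n₁ j : ℝ) + n₂ j)⁻¹) := by
        gcongr
    _ ≤ r₁ * (2 / p * ((n₁ j : ℝ) + n₂ j)⁻¹) + r₂ * (2 / (1 - p) * ((n₁ j : ℝ) + n₂ j)⁻¹) +
        ((n₁ j : ℝ) + n₂ j)⁻¹ := le_add_of_nonneg_right (by positivity)
    _ = _ := by ring

lemma eventually_radius_small (d : ℕ) (hd : 1 ≤ d) {ε : ℕ → ℝ} (hε_pos : ∀ j, 0 < ε j)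
    (hε : Tendsto ε atTop (𝓝 0)) : ∀ᶠ j in atTop, ε j ≤ 1 ∧ ballVol d (ε j) ≤ 1 := by
  have h : Tendsto (fun j => ε j ^ d * ballVol d 1) atTop (𝓝 0) := by
    have := (hε.pow d).mul_const (ballVol d 1)
    rwa [zero_pow (by omega), zero_mul] at this
  filter_upwards [hε.eventually (ge_mem_nhds one_pos), h.eventually (ge_mem_nhds one_pos)]
    with j h1 h2
  exact ⟨h1, by rwa [ballVol_eq (hε_pos j).le]⟩

/-- The contribution of the overlap `m`, with the dependence on the radius and on the sample size
made explicit. -/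
lemma overlap_contribution_le {d m : ℕ} (hm : 1 ≤ m) {n ε ρ R K : ℝ} (hK : 0 ≤ K)
    (hε : 0 < ε) (hρ0 : 0 ≤ ρ) (hρ : ρ ≤ R * n⁻¹) :
    K * ((ballVol d ε)⁻¹) ^ (m - 1) * ρ ^ m ≤
      (K * R ^ m * ((ballVol d 1)⁻¹) ^ (m - 1)) * (n⁻¹ * ((n * ε ^ d)⁻¹) ^ (m - 1)) := by
  have hb := ballVol_pos (d := d) one_pos
  have h1 : ρ ^ m ≤ (R * n⁻¹) ^ m := pow_le_pow_left₀ hρ0 hρ m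
  have h2 : (n⁻¹) ^ m = n⁻¹ * (n⁻¹) ^ (m - 1) := by
    rw [← pow_succ', Nat.sub_add_cancel hm]
  calc K * ((ballVol d ε)⁻¹) ^ (m - 1) * ρ ^ m
      ≤ K * ((ballVol d ε)⁻¹) ^ (m - 1) * (R * n⁻¹) ^ m :=
        mul_le_mul_of_nonneg_left h1
          (mul_nonneg hK (pow_nonneg (inv_nonneg.2 (ballVol_nonneg _)) _))
    _ = _ := by
        rw [ballVol_eq hε.le, mul_pow R, h2, mul_inv, mul_inv, mul_pow, mul_pow]
        ring

/-- Convergence to zero in mean square implies convergence in probability. -/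
lemma tendstoInMeasure_of_integral_sq {Ω : Type*} [MeasurableSpace Ω] {μ : Measure Ω}
    {F : ℕ → Ω → ℝ} (hF : ∀ j, MemLp (F j) 2 μ)
    (h : Tendsto (fun j => ∫ ω, F j ω ^ 2 ∂μ) atTop (𝓝 0)) :
    TendstoInMeasure μ F atTop 0 := by
  refine tendstoInMeasure_of_tendsto_eLpNorm (p := 2) (by norm_num)
    (fun j => (hF j).aestronglyMeasurable) aestronglyMeasurable_zero ?_
  have h1 : ∀ j, eLpNorm (F j - 0) 2 μ = ENNReal.ofReal (√(∫ ω, F j ω ^ 2 ∂μ)) := by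
    intro j
    rw [sub_zero, (hF j).eLpNorm_eq_integral_rpow_norm (by norm_num) (by norm_num)]
    congr 1
    rw [Real.sqrt_eq_rpow]
    norm_num
  simp_rw [h1]
  have := (ENNReal.continuous_ofReal.comp Real.continuous_sqrt).tendsto 0 |>.comp h
  simpa [Function.comp_def] using this

variable {Ω : Type*} [MeasurableSpace Ω] {d : ℕ}
  {μ : Measure Ω} [IsProbabilityMeasure μ] {Z : ℕ ⊕ ℕ → Ω → Sp d} {pX pY : Sp d → ℝ}
  {M : ℝ} {r₁ r₂ : ℕ} {n₁ n₂ : ℕ → ℕ} {ε : ℕ → ℝ} {p : ℝ}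

lemma memLp_estimator (hs : IndepSample μ Z (jointDensity pX pY) M) {e : ℝ} (he : 0 < e)
    (r₁ r₂ k₁ k₂ : ℕ) : MemLp (estimator Z r₁ r₂ k₁ k₂ e) 2 μ := by
  have hK : ∀ A, MemLp (fun ω => normKernel e A (fun i => Z i ω)) 2 μ := fun A => by
    have hm := (measurable_normKernel e A).comp hs.measurable_pi
    exact MemLp.of_bound hm.aestronglyMeasurable (1 / ballVol d e ^ (A.card - 1))
      (ae_of_all _ fun ω => abs_normKernel_le e A _)
  have h := (memLp_finsetSum (samplePairs r₁ r₂ k₁ k₂)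
    fun s _ => hK (s.1.disjSum s.2)).const_mul ((samplePairs r₁ r₂ k₁ k₂).card : ℝ)⁻¹
  exact h.ae_eq (ae_of_all _ fun ω => (estimator_eq he r₁ r₂ k₁ k₂ ω).symm)

/-- The mean square error around `q̃_{r,ε}` has order `n⁻¹ ε^{d(1/r-1)}` if `n ε^{d(1-1/r)}` is
bounded away from zero. -/
lemma exists_integral_sq_estimator_sub_le_rate (hs : IndepSample μ Z (jointDensity pX pY) M)
    (hd : 1 ≤ d) (hr₁ : 1 ≤ r₁)
    (hn₁ : Tendsto n₁ atTop atTop) (hn₂ : Tendsto n₂ atTop atTop) (hp₀ : 0 < p) (hp₁ : p < 1)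
    (hp : Tendsto (fun j => (n₁ j : ℝ) / ((n₁ j : ℝ) + (n₂ j : ℝ))) atTop (𝓝 p))
    (hε_pos : ∀ j, 0 < ε j) (hε : Tendsto ε atTop (𝓝 0)) {c : ℝ} (hc : 0 < c)
    (h : ∀ᶠ j in atTop, c ≤ ((n₁ j : ℝ) + n₂ j) *
      ε j ^ ((d : ℝ) * (1 - 1 / ((r₁ : ℝ) + r₂)))) :
    ∃ K, ∀ᶠ j in atTop,
      ∫ ω, (estimator Z r₁ r₂ (n₁ j) (n₂ j) (ε j) ω - qTilde r₁ r₂ pX pY (ε j)) ^ 2 ∂μ ≤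
        K * (((n₁ j : ℝ) + n₂ j)⁻¹ * ε j ^ ((d : ℝ) * (1 / ((r₁ : ℝ) + r₂) - 1))) := by
  obtain ⟨K, hK, hvar⟩ := exists_integral_sq_estimator_sub_le hs hr₁ r₂
  obtain ⟨R, hR, hρ⟩ := exists_eventually_overlap_le r₁ r₂ hn₁ hp₀ hp₁ hp
  have hb := ballVol_pos (d := d) one_pos
  refine ⟨∑ m ∈ Finset.range (r₁ + r₂ + 1), ((r₁ + r₂).choose m : ℝ) *
    ((K * R ^ m * ((ballVol d 1)⁻¹) ^ (m - 1)) * (c⁻¹) ^ (m - 1)), ?_⟩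
  filter_upwards [hρ, h, eventually_radius_small d hd hε_pos hε, hn₁.eventually_ge_atTop r₁,
    hn₂.eventually_ge_atTop r₂] with j hρj hj hεj h1 h2
  have hn : 0 < (n₁ j : ℝ) + n₂ j := by
    have : (1 : ℝ) ≤ n₁ j := by exact_mod_cast hr₁.trans h1
    positivity
  refine (hvar _ _ _ (hε_pos j) hεj.2 h1 h2).trans ?_
  rw [Finset.sum_mul]
  refine Finset.sum_le_sum fun m hm => ?_
  rw [mul_assoc]
  refine mul_le_mul_of_nonneg_left ?_ (Nat.cast_nonneg ((r₁ + r₂).choose m))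
  have hεp : 0 < ε j ^ ((d : ℝ) * (1 / ((r₁ : ℝ) + r₂) - 1)) := Real.rpow_pos_of_pos (hε_pos j) _
  split_ifs with hm0
  · rw [zero_mul]
    positivity
  · have hm1 : 1 ≤ m := Nat.one_le_iff_ne_zero.2 hm0
    refine (overlap_contribution_le hm1 hK (hε_pos j) (by positivity) hρj).trans ?_
    have hmr : m ≤ r₁ + r₂ := Nat.lt_succ_iff.1 (Finset.mem_range.1 hm)
    have h3 := overlap_term_le (d := d) (r := r₁ + r₂) hm1 hmr (hε_pos j) hεj.1 hc
      (by push_cast; exact hj)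
    push_cast at h3
    have h4 : 0 ≤ K * R ^ m * ((ballVol d 1)⁻¹) ^ (m - 1) := by positivity
    refine (mul_le_mul_of_nonneg_left (mul_le_mul_of_nonneg_left h3 (inv_nonneg.2 hn.le))
      h4).trans_eq ?_
    ring

end Rates

/-! ### Linearization and the central limit theorem -/

section Projection

variable {Ω : Type*} [MeasurableSpace Ω] {d : ℕ}
  {μ : Measure Ω} [IsProbabilityMeasure μ] {Z : ℕ ⊕ ℕ → Ω → Sp d} {pX pY : Sp d → ℝ}
  {M : ℝ} {r₁ r₂ : ℕ} {n₁ n₂ : ℕ → ℕ} {ε : ℕ → ℝ} {p : ℝ}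

/-- The centred limits of the conditional means of the kernel given one sample point: the summands
of the asymptotic linearization of the estimator. -/
noncomputable def influence (r₁ r₂ : ℕ) (pX pY : Sp d → ℝ) : ℕ ⊕ ℕ → Sp d → ℝ :=
  Sum.elim (fun _ x => limitX r₁ r₂ pX pY x - q r₁ r₂ pX pY)
    fun _ x => limitY r₁ r₂ pX pY x - q r₁ r₂ pX pY

lemma measurable_influence (hX : BoundedDensity pX M) (hY : BoundedDensity pY M) (i : ℕ ⊕ ℕ) :
    Measurable (influence r₁ r₂ pX pY i) := by
  rcases i with i | i
  · exact (measurable_limitX hX hY).sub_const _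
  · exact (measurable_limitY hX hY).sub_const _

lemma exists_abs_influence_le (hX : BoundedDensity pX M) (hY : BoundedDensity pY M) :
    ∃ C, ∀ i x, |influence r₁ r₂ pX pY i x| ≤ C := by
  refine ⟨max (M ^ (r₁ - 1 + r₂)) (M ^ (r₁ + (r₂ - 1))) + |q r₁ r₂ pX pY|, fun i x => ?_⟩
  rcases i with i | i
  · exact (abs_sub _ _).trans
      (add_le_add ((abs_limitX_le hX hY x).trans (le_max_left _ _)) le_rfl)
  · exact (abs_sub _ _).trans
      (add_le_add ((abs_limitY_le hX hY x).trans (le_max_right _ _)) le_rfl)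

lemma integral_influence (hX : BoundedDensity pX M) (hY : BoundedDensity pY M) (hr₁ : 1 ≤ r₁)
    (A : Finset (ℕ ⊕ ℕ)) (hA : A.toRight.card = r₂) (i : ℕ ⊕ ℕ) (hi : i ∈ A) :
    ∫ x, influence r₁ r₂ pX pY i x ∂(law (jointDensity pX pY i)) = 0 := by
  have h1 := hX.prob
  have h2 := hY.prob
  rcases i with i | i
  · have hint : Integrable (limitX r₁ r₂ pX pY) (law pX) :=
      Integrable.of_bound (measurable_limitX hX hY).aestronglyMeasurable _
        (ae_of_all _ (abs_limitX_le hX hY))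
    simp only [influence, jointDensity, Sum.elim_inl]
    rw [integral_sub hint (integrable_const _), integral_limitX hX hr₁]
    simp
  · have hr₂ : 1 ≤ r₂ := hA ▸ Finset.card_pos.2 ⟨i, Finset.mem_toRight.2 hi⟩
    have hint : Integrable (limitY r₁ r₂ pX pY) (law pY) :=
      Integrable.of_bound (measurable_limitY hX hY).aestronglyMeasurable _
        (ae_of_all _ (abs_limitY_le hX hY))
    simp only [influence, jointDensity, Sum.elim_inr]
    rw [integral_sub hint (integrable_const _), integral_limitY hY hr₂]
    simp

/-- The linearization of the estimator: a sum of two independent averages of i.i.d. variables. -/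
noncomputable def linearPart (Z : ℕ ⊕ ℕ → Ω → Sp d) (r₁ r₂ : ℕ) (pX pY : Sp d → ℝ) (n₁ n₂ : ℕ)
    (ω : Ω) : ℝ :=
  (r₁ / n₁ : ℝ) * ∑ i ∈ Finset.range n₁, influence r₁ r₂ pX pY (Sum.inl i) (Z (Sum.inl i) ω) +
    (r₂ / n₂ : ℝ) * ∑ k ∈ Finset.range n₂, influence r₁ r₂ pX pY (Sum.inr k) (Z (Sum.inr k) ω)

lemma memLp_influence (hs : IndepSample μ Z (jointDensity pX pY) M) (i : ℕ ⊕ ℕ) :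
    MemLp (fun ω => influence r₁ r₂ pX pY i (Z i ω)) 2 μ := by
  obtain ⟨C, hC⟩ := exists_abs_influence_le (r₁ := r₁) (r₂ := r₂) hs.densityX hs.densityY
  have hm := (measurable_influence (r₁ := r₁) (r₂ := r₂) hs.densityX hs.densityY i).comp (hs.meas i)
  exact MemLp.of_bound hm.aestronglyMeasurable C (ae_of_all _ fun ω => hC i _)

lemma memLp_linearPart (hs : IndepSample μ Z (jointDensity pX pY) M) (r₁ r₂ k₁ k₂ : ℕ) :
    MemLp (linearPart Z r₁ r₂ pX pY k₁ k₂) 2 μ :=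
  ((memLp_finsetSum _ fun i _ => memLp_influence hs (Sum.inl i)).const_mul _).add
    ((memLp_finsetSum _ fun k _ => memLp_influence hs (Sum.inr k)).const_mul _)

/-- For two index sets with a single common element, the mixed moment of the residuals after
linearization is the mean square distance of the conditional mean of the kernel from its limit. -/
lemma integral_residual_influence_mul_le (hs : IndepSample μ Z (jointDensity pX pY) M)
    (hr₁ : 1 ≤ r₁) {e : ℝ} (he : 0 < e) {A B : Finset (ℕ ⊕ ℕ)}
    (hA₁ : A.toLeft.card = r₁) (hA₂ : A.toRight.card = r₂)
    (hB₁ : B.toLeft.card = r₁) (hB₂ : B.toRight.card = r₂) (hAB : (A ∩ B).card = 1) :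
    ∫ ω, residual r₁ r₂ pX pY (influence r₁ r₂ pX pY) e A (fun i => Z i ω) *
      residual r₁ r₂ pX pY (influence r₁ r₂ pX pY) e B (fun i => Z i ω) ∂μ ≤
      (∫ x, (condMeanX r₁ r₂ pX pY e x - qTilde r₁ r₂ pX pY e -
        (limitX r₁ r₂ pX pY x - q r₁ r₂ pX pY)) ^ 2 ∂(law pX)) +
      ∫ x, (condMeanY r₁ r₂ pX pY e x - qTilde r₁ r₂ pX pY e -
        (limitY r₁ r₂ pX pY x - q r₁ r₂ pX pY)) ^ 2 ∂(law pY) := by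
  obtain ⟨c, hc⟩ := Finset.card_eq_one.1 hAB
  have hcAB := Finset.mem_inter.1 (show c ∈ A ∩ B by simp [hc])
  obtain ⟨C, hC⟩ := exists_abs_influence_le (r₁ := r₁) (r₂ := r₂) hs.densityX hs.densityY
  have hm := measurable_influence (r₁ := r₁) (r₂ := r₂) hs.densityX hs.densityY
  have hA0 := integral_influence hs.densityX hs.densityY hr₁ A hA₂
  have hB0 := integral_influence hs.densityX hs.densityY hr₁ B hB₂
  rcases c with c | c
  · rw [integral_residual_mul_of_inter_eq_singleton hs hr₁ hm hC he hA0 hB0 hc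
      (integral_normKernel_update_inl hs he hA₁ hA₂ hcAB.1)
      (integral_normKernel_update_inl hs he hB₁ hB₂ hcAB.2)]
    exact le_add_of_nonneg_right (integral_nonneg fun _ => sq_nonneg _)
  · rw [integral_residual_mul_of_inter_eq_singleton hs hr₁ hm hC he hA0 hB0 hc
      (integral_normKernel_update_inr hs he hr₁ hA₁ hA₂ hcAB.1)
      (integral_normKernel_update_inr hs he hr₁ hB₁ hB₂ hcAB.2)]
    exact le_add_of_nonneg_left (integral_nonneg fun _ => sq_nonneg _)

/-- If `n ε^d → ∞`, the linearization error is of smaller order than `n^{-1/2}` in mean square. -/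
lemma tendsto_mul_integral_sq_linearization (hs : IndepSample μ Z (jointDensity pX pY) M)
    (hd : 1 ≤ d) (hr₁ : 1 ≤ r₁)
    (hn₁ : Tendsto n₁ atTop atTop) (hn₂ : Tendsto n₂ atTop atTop) (hp₀ : 0 < p) (hp₁ : p < 1)
    (hp : Tendsto (fun j => (n₁ j : ℝ) / ((n₁ j : ℝ) + (n₂ j : ℝ))) atTop (𝓝 p))
    (hε_pos : ∀ j, 0 < ε j) (hε : Tendsto ε atTop (𝓝 0))
    (h : Tendsto (fun j => ((n₁ j : ℝ) + n₂ j) * ε j ^ d) atTop atTop) :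
    Tendsto (fun j => ((n₁ j : ℝ) + n₂ j) *
      ∫ ω, (estimator Z r₁ r₂ (n₁ j) (n₂ j) (ε j) ω - qTilde r₁ r₂ pX pY (ε j) -
        linearPart Z r₁ r₂ pX pY (n₁ j) (n₂ j) ω) ^ 2 ∂μ) atTop (𝓝 0) := by
  have hX := hs.densityX
  have hY := hs.densityY
  obtain ⟨C, hC⟩ := exists_abs_influence_le (r₁ := r₁) (r₂ := r₂) hX hY
  have hm := measurable_influence (r₁ := r₁) (r₂ := r₂) hX hY
  obtain ⟨K, hK, hmix⟩ := exists_integral_residual_mul_le (r₂ := r₂) hs hr₁ hm hC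
  obtain ⟨R, hR, hρ⟩ := exists_eventually_overlap_le r₁ r₂ hn₁ hp₀ hp₁ hp
  set δ : ℕ → ℝ := fun j =>
    (∫ x, (condMeanX r₁ r₂ pX pY (ε j) x - qTilde r₁ r₂ pX pY (ε j) -
        (limitX r₁ r₂ pX pY x - q r₁ r₂ pX pY)) ^ 2 ∂(law pX)) +
      ∫ x, (condMeanY r₁ r₂ pX pY (ε j) x - qTilde r₁ r₂ pX pY (ε j) -
        (limitY r₁ r₂ pX pY x - q r₁ r₂ pX pY)) ^ 2 ∂(law pY) with hδ
  have hδ0 : ∀ j, 0 ≤ δ j := fun j =>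
    add_nonneg (integral_nonneg fun _ => sq_nonneg _) (integral_nonneg fun _ => sq_nonneg _)
  have hδt : Tendsto δ atTop (𝓝 0) := by
    have := (tendsto_integral_sq_condMeanX_sub (r₁ := r₁) (r₂ := r₂) hX hY hr₁ hε_pos hε).add
      (tendsto_integral_sq_condMeanY_sub (r₁ := r₁) (r₂ := r₂) hX hY hr₁ hε_pos hε)
    rwa [add_zero] at this
  -- the contribution of the overlap `m`, after multiplication by the sample size
  set u : ℕ → ℕ → ℝ := fun j m => if m = 0 then 0 else if m = 1 then R * δ j else
    (K * R ^ m * ((ballVol d 1)⁻¹) ^ (m - 1)) * ((((n₁ j : ℝ) + n₂ j) * ε j ^ d)⁻¹) ^ (m - 1)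
    with hu
  have hut : Tendsto (fun j => ∑ m ∈ Finset.range (r₁ + r₂ + 1), ((r₁ + r₂).choose m : ℝ) * u j m)
      atTop (𝓝 0) := by
    have : (0 : ℝ) = ∑ m ∈ Finset.range (r₁ + r₂ + 1), ((r₁ + r₂).choose m : ℝ) * 0 := by simp
    rw [this]
    refine tendsto_finsetSum _ fun m _ => Tendsto.const_mul _ ?_
    simp only [hu]
    split_ifs with h0 h1
    · exact tendsto_const_nhds
    · simpa using hδt.const_mul R
    · have h2 := ((tendsto_inv_atTop_zero.comp h).pow (m - 1)).const_mul
        (K * R ^ m * ((ballVol d 1)⁻¹) ^ (m - 1))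
      rw [zero_pow (by omega), mul_zero] at h2
      exact h2
  refine squeeze_zero' ?_ ?_ hut
  · exact Eventually.of_forall fun j => mul_nonneg (by positivity)
      (integral_nonneg fun _ => sq_nonneg _)
  filter_upwards [hρ, eventually_radius_small d hd hε_pos hε, hn₁.eventually_ge_atTop r₁,
    hn₂.eventually_ge_atTop r₂] with j hρj hεj h1 h2
  have hn : 0 < (n₁ j : ℝ) + n₂ j := by
    have : (1 : ℝ) ≤ n₁ j := by exact_mod_cast hr₁.trans h1
    positivity
  have hbn := ballVol_nonneg (d := d) (ε j)
  have hmain := integral_sq_estimator_sub_le (ε := ε j)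
    (v := fun m => if m = 0 then 0 else if m = 1 then δ j else
      K * ((ballVol d (ε j))⁻¹) ^ (m - 1)) hs hr₁ hm hC
    (integral_influence hX hY hr₁) (hε_pos j) h1 h2
    (fun m => by
      have := hδ0 j
      split_ifs <;> positivity)
    (fun A B a1 a2 b1 b2 h0 => by
      rw [if_neg (by omega)]
      split_ifs with hone
      · exact integral_residual_influence_mul_le hs hr₁ (hε_pos j) a1 a2 b1 b2 hone
      · exact hmix (ε j) (hε_pos j) hεj.2 A B a1 a2 b1 b2 h0)
  refine (mul_le_mul_of_nonneg_left hmain hn.le).trans ?_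
  rw [Finset.mul_sum]
  refine Finset.sum_le_sum fun m _ => ?_
  rw [mul_left_comm]
  refine mul_le_mul_of_nonneg_left ?_ (Nat.cast_nonneg ((r₁ + r₂).choose m))
  have hρ0 : (0 : ℝ) ≤ r₁ / n₁ j + r₂ / n₂ j := by positivity
  simp only [hu]
  split_ifs with h0 hone
  · simp
  · subst hone
    rw [pow_one]
    calc _ ≤ ((n₁ j : ℝ) + n₂ j) * (δ j * (R * ((n₁ j : ℝ) + n₂ j)⁻¹)) := by
          have := hδ0 j
          gcongr
      _ = R * δ j := by field_simp
  · refine (mul_le_mul_of_nonneg_left (overlap_contribution_le (Nat.one_le_iff_ne_zero.2 h0) hK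
      (hε_pos j) hρ0 hρj) hn.le).trans_eq ?_
    generalize (((n₁ j : ℝ) + n₂ j) * ε j ^ d)⁻¹ ^ (m - 1) = t
    field_simp

end Projection

section CentralLimit

variable {Ω : Type*} [MeasurableSpace Ω] {μ : Measure Ω} [IsProbabilityMeasure μ]

/-- Sums of independent, asymptotically normal sequences are asymptotically normal. -/
lemma tendstoInDistribution_add_of_indepFun {U V : ℕ → Ω → ℝ} {v w : NNReal}
    {Ω₁ Ω₂ : Type*} [MeasurableSpace Ω₁] [MeasurableSpace Ω₂] {ν₁ : Measure Ω₁} {ν₂ : Measure Ω₂}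
    [IsProbabilityMeasure ν₁] [IsProbabilityMeasure ν₂] {S : Ω₁ → ℝ} {T : Ω₂ → ℝ}
    (hS : ν₁.map S = gaussianReal 0 v) (hT : ν₂.map T = gaussianReal 0 w)
    (hU : TendstoInDistribution U atTop S (fun _ => μ) ν₁)
    (hV : TendstoInDistribution V atTop T (fun _ => μ) ν₂) (hUV : ∀ j, IndepFun (U j) (V j) μ) :
    TendstoInDistribution (fun j ω => U j ω + V j ω) atTop (id : ℝ → ℝ) (fun _ => μ)
      (gaussianReal 0 (v + w)) where
  forall_aemeasurable j := (hU.forall_aemeasurable j).add (hV.forall_aemeasurable j)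
  tendsto := by
    refine ProbabilityMeasure.tendsto_iff_tendsto_charFun.2 fun t => ?_
    have h1 := ProbabilityMeasure.tendsto_iff_tendsto_charFun.1 hU.tendsto t
    have h2 := ProbabilityMeasure.tendsto_iff_tendsto_charFun.1 hV.tendsto t
    simp only [ProbabilityMeasure.coe_mk, hS, hT, Measure.map_id] at h1 h2 ⊢
    have h3 : charFun (gaussianReal 0 (v + w)) t =
        charFun (gaussianReal 0 v) t * charFun (gaussianReal 0 w) t := by
      rw [charFun_gaussianReal, charFun_gaussianReal, charFun_gaussianReal, ← Complex.exp_add]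
      congr 1
      push_cast
      ring
    rw [h3]
    refine (h1.mul h2).congr fun j => ?_
    rw [(hUV j).charFun_map_fun_add_eq_mul (hU.forall_aemeasurable j) (hV.forall_aemeasurable j)]
    rfl

/-- The central limit theorem along sample sizes `k j → ∞`, with factors `α j → α`. -/
lemma tendstoInDistribution_mul_inv_sqrt_mul_sum {E : Type*} [MeasurableSpace E] {ν : Measure E}
    {X : ℕ → Ω → E} (hm : ∀ i, Measurable (X i)) (hlaw : ∀ i, μ.map (X i) = ν)
    (hind : iIndepFun X μ) {f : E → ℝ} (hf : Measurable f) {C : ℝ} (hC : ∀ x, |f x| ≤ C)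
    {k : ℕ → ℕ} (hk : Tendsto k atTop atTop) {α : ℕ → ℝ} {α₀ : ℝ}
    (hα : Tendsto α atTop (𝓝 α₀)) :
    TendstoInDistribution
      (fun j ω => α j * ((√(k j))⁻¹ * (∑ i ∈ Finset.range (k j), (f (X i ω) - ∫ x, f x ∂ν))))
      atTop (fun x : ℝ => α₀ * x) (fun _ => μ) (gaussianReal 0 Var[f; ν].toNNReal) := by
  have hid : ∀ i, IdentDistrib (fun ω => f (X i ω)) (fun ω => f (X 0 ω)) μ μ := fun i =>
    IdentDistrib.comp (u := f) ⟨(hm i).aemeasurable, (hm 0).aemeasurable, by rw [hlaw, hlaw]⟩ hf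
  have hvar : Var[fun ω => f (X 0 ω); μ] = Var[f; ν] := by
    rw [← hlaw 0, variance_map hf.aemeasurable (hm 0).aemeasurable]
    rfl
  have hmean : ∫ ω, f (X 0 ω) ∂μ = ∫ x, f x ∂ν := by
    rw [← hlaw 0, integral_map (hm 0).aemeasurable hf.aestronglyMeasurable]
  have hclt := tendstoInDistribution_inv_sqrt_mul_sum_sub (P := μ)
    (P' := gaussianReal 0 Var[f; ν].toNNReal) (X := fun i ω => f (X i ω)) (Y := id)
    ⟨aemeasurable_id, by rw [Measure.map_id, hvar]⟩
    (MemLp.of_bound (hf.comp (hm 0)).aestronglyMeasurable C (ae_of_all _ fun ω => hC _))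
    (hind.comp (fun _ => f) fun _ => hf) hid
  have hsub : TendstoInDistribution
      (fun j ω => (√(k j))⁻¹ * (∑ i ∈ Finset.range (k j), (f (X i ω) - ∫ x, f x ∂ν)))
      atTop (id : ℝ → ℝ) (fun _ => μ) (gaussianReal 0 Var[f; ν].toNNReal) := by
    have h1 : TendstoInDistribution
        (fun j ω => (√(k j))⁻¹ * (∑ i ∈ Finset.range (k j), f (X i ω) -
          k j * ∫ ω, f (X 0 ω) ∂μ))
        atTop (id : ℝ → ℝ) (fun _ => μ) (gaussianReal 0 Var[f; ν].toNNReal) :=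
      ⟨fun j => hclt.forall_aemeasurable (k j), hclt.aemeasurable_limit, hclt.tendsto.comp hk⟩
    simpa only [Finset.sum_sub_distrib, Finset.sum_const, Finset.card_range, nsmul_eq_mul, hmean]
      using h1
  have hαm : TendstoInMeasure μ (fun j (_ : Ω) => α j) atTop fun _ => α₀ :=
    tendstoInMeasure_of_tendsto_ae (fun j => aestronglyMeasurable_const) (ae_of_all _ fun _ => hα)
  have := hsub.continuous_comp_prodMk_of_tendstoInMeasure_const (g := fun x : ℝ × ℝ => x.2 * x.1)
    (by fun_prop) hαm fun j => aemeasurable_const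
  exact this

end CentralLimit

/-! ### Consistency and asymptotic normality -/

section Normality

variable {Ω : Type*} [MeasurableSpace Ω] {d : ℕ}
  {μ : Measure Ω} [IsProbabilityMeasure μ] {Z : ℕ ⊕ ℕ → Ω → Sp d} {pX pY : Sp d → ℝ}
  {M : ℝ} {r₁ r₂ : ℕ} {n₁ n₂ : ℕ → ℕ} {ε : ℕ → ℝ} {p : ℝ}

lemma sqrt_mul_div_mul_sum (n : ℝ) {k : ℕ} (hk : 1 ≤ k) (hn : 0 ≤ n) (r s : ℝ) :
    √n * (r / k * s) = r * √(n / k) * ((√(k : ℝ))⁻¹ * s) := by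
  have hk' : (0 : ℝ) < k := by exact_mod_cast hk
  rw [Real.sqrt_div hn]
  have h1 : √(k : ℝ) ≠ 0 := (Real.sqrt_pos.2 hk').ne'
  have h2 : (k : ℝ) = √(k : ℝ) * √(k : ℝ) := (Real.mul_self_sqrt hk'.le).symm
  rw [show r / (k : ℝ) = r / (√(k : ℝ) * √(k : ℝ)) by rw [← h2]]
  field_simp

/-- The two limiting variances add up to `κ`. -/
lemma toNNReal_kappa (hr₁ : 1 ≤ r₁) (hp₀ : 0 < p) (hp₁ : p < 1) :
    (kappa r₁ r₂ pX pY p).toNNReal =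
      .mk ((r₁ * √(1 / p)) ^ 2) (sq_nonneg _) * (Var[limitX r₁ r₂ pX pY; law pX]).toNNReal +
      .mk ((r₂ * √(1 / (1 - p))) ^ 2) (sq_nonneg _) *
        (Var[limitY r₁ r₂ pX pY; law pY]).toNNReal := by
  have hp1 : 0 < 1 - p := by linarith
  have h : kappa r₁ r₂ pX pY p = (r₁ * √(1 / p)) ^ 2 * Var[limitX r₁ r₂ pX pY; law pX] +
      (r₂ * √(1 / (1 - p))) ^ 2 * Var[limitY r₁ r₂ pX pY; law pY] := by
    rw [mul_pow, mul_pow, Real.sq_sqrt (by positivity), Real.sq_sqrt (by positivity), kappa,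
      zeta10_eq hr₁]
    -- for `r₂ = 0` the variance `ζ_{0,1}` involves negative powers, but its coefficient vanishes
    rcases Nat.eq_zero_or_pos r₂ with rfl | hr₂
    · rw [Nat.cast_zero]
      ring
    · rw [zeta01_eq hr₂]
      ring
  have hx := variance_nonneg (limitX r₁ r₂ pX pY) (law pX)
  have hy := variance_nonneg (limitY r₁ r₂ pX pY) (law pY)
  refine NNReal.eq ?_
  rw [h, Real.coe_toNNReal _ (by positivity)]
  rw [NNReal.coe_add, NNReal.coe_mul, NNReal.coe_mul, Real.coe_toNNReal _ hx,
    Real.coe_toNNReal _ hy]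
  rfl

/-- Asymptotic normality of the linearization. -/
lemma tendstoInDistribution_linearPart (hs : IndepSample μ Z (jointDensity pX pY) M)
    (hr₁ : 1 ≤ r₁) (hn₁ : Tendsto n₁ atTop atTop) (hn₂ : Tendsto n₂ atTop atTop)
    (hp₀ : 0 < p) (hp₁ : p < 1)
    (hp : Tendsto (fun j => (n₁ j : ℝ) / ((n₁ j : ℝ) + (n₂ j : ℝ))) atTop (𝓝 p)) :
    TendstoInDistribution
      (fun j ω => √((n₁ j : ℝ) + n₂ j) * linearPart Z r₁ r₂ pX pY (n₁ j) (n₂ j) ω) atTop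
      (id : ℝ → ℝ) (fun _ => μ) (gaussianReal 0 (kappa r₁ r₂ pX pY p).toNNReal) := by
  have hX := hs.densityX
  have hY := hs.densityY
  have hp1 : 0 < 1 - p := by linarith
  -- the factors in front of the normalized sums
  have hα : Tendsto (fun j => (r₁ : ℝ) * √(((n₁ j : ℝ) + n₂ j) / n₁ j)) atTop
      (𝓝 (r₁ * √(1 / p))) := by
    refine Tendsto.const_mul _ ((Real.continuous_sqrt.tendsto _).comp ?_)
    have := hp.inv₀ hp₀.ne'
    simpa [inv_div] using this
  have hβ : Tendsto (fun j => (r₂ : ℝ) * √(((n₁ j : ℝ) + n₂ j) / n₂ j)) atTop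
      (𝓝 (r₂ * √(1 / (1 - p)))) := by
    refine Tendsto.const_mul _ ((Real.continuous_sqrt.tendsto _).comp ?_)
    have := (hp.const_sub 1).inv₀ hp1.ne'
    rw [one_div]
    refine this.congr' ?_
    filter_upwards [hn₁.eventually_ge_atTop 1] with j h1
    have : (0 : ℝ) < n₁ j := by exact_mod_cast h1
    have h2 : 0 < (n₁ j : ℝ) + n₂ j := by positivity
    rw [← inv_div]
    field_simp
    ring
  have hU := tendstoInDistribution_mul_inv_sqrt_mul_sum (μ := μ) (ν := law pX)
    (X := fun i => Z (Sum.inl i)) (fun i => hs.meas _) (fun i => hs.map_eq _)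
    (hs.indep.precomp Sum.inl_injective) (measurable_limitX (r₁ := r₁) (r₂ := r₂) hX hY)
    (abs_limitX_le hX hY) hn₁ hα
  have hV := tendstoInDistribution_mul_inv_sqrt_mul_sum (μ := μ) (ν := law pY)
    (X := fun i => Z (Sum.inr i)) (fun i => hs.meas _) (fun i => hs.map_eq _)
    (hs.indep.precomp Sum.inr_injective) (measurable_limitY (r₁ := r₁) (r₂ := r₂) hX hY)
    (abs_limitY_le hX hY) hn₂ hβ
  have hind : ∀ j, IndepFun
      (fun ω => (r₁ : ℝ) * √(((n₁ j : ℝ) + n₂ j) / n₁ j) * ((√(n₁ j : ℝ))⁻¹ *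
        ∑ i ∈ Finset.range (n₁ j), (limitX r₁ r₂ pX pY (Z (Sum.inl i) ω) -
          ∫ x, limitX r₁ r₂ pX pY x ∂(law pX))))
      (fun ω => (r₂ : ℝ) * √(((n₁ j : ℝ) + n₂ j) / n₂ j) * ((√(n₂ j : ℝ))⁻¹ *
        ∑ i ∈ Finset.range (n₂ j), (limitY r₁ r₂ pX pY (Z (Sum.inr i) ω) -
          ∫ x, limitY r₁ r₂ pX pY x ∂(law pY)))) μ := fun j => by
    refine indepFun_of_dependsOn hs.indep hs.meas
      (A := (Finset.range (n₁ j)).disjSum ∅) (B := (∅ : Finset ℕ).disjSum (Finset.range (n₂ j)))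
      (F := fun z => (r₁ : ℝ) * √(((n₁ j : ℝ) + n₂ j) / n₁ j) * ((√(n₁ j : ℝ))⁻¹ *
        ∑ i ∈ Finset.range (n₁ j), (limitX r₁ r₂ pX pY (z (Sum.inl i)) -
          ∫ x, limitX r₁ r₂ pX pY x ∂(law pX))))
      (G := fun z => (r₂ : ℝ) * √(((n₁ j : ℝ) + n₂ j) / n₂ j) * ((√(n₂ j : ℝ))⁻¹ *
        ∑ i ∈ Finset.range (n₂ j), (limitY r₁ r₂ pX pY (z (Sum.inr i)) -
          ∫ x, limitY r₁ r₂ pX pY x ∂(law pY)))) ?_ ?_ ?_ ?_ ?_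
    · exact ((Finset.measurable_fun_sum _ fun i _ => ((measurable_limitX hX hY).comp
        (measurable_pi_apply (Sum.inl i))).sub_const _).const_mul _).const_mul _
    · exact ((Finset.measurable_fun_sum _ fun i _ => ((measurable_limitY hX hY).comp
        (measurable_pi_apply (Sum.inr i))).sub_const _).const_mul _).const_mul _
    · intro z w h
      simp only
      rw [Finset.sum_congr rfl fun i hi => by rw [h (Sum.inl i) (by simpa using hi)]]
    · intro z w h
      simp only
      rw [Finset.sum_congr rfl fun i hi => by rw [h (Sum.inr i) (by simpa using hi)]]
    · rw [Finset.disjoint_left]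
      rintro (i | i) h1 h2
      · simp at h2
      · simp at h1
  have hmap : ∀ (a : ℝ) (v : NNReal), (gaussianReal 0 v).map (fun x => a * x) =
      gaussianReal 0 (.mk (a ^ 2) (sq_nonneg _) * v) := fun a v => by
    have := gaussianReal_map_const_mul (μ := 0) (v := v) a
    rwa [mul_zero] at this
  have h := tendstoInDistribution_add_of_indepFun (hmap _ _) (hmap _ _) hU hV hind
  rw [← toNNReal_kappa hr₁ hp₀ hp₁] at h
  refine ⟨fun j => ((memLp_linearPart hs r₁ r₂ _ _).aestronglyMeasurable.aemeasurable).const_mul _,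
    aemeasurable_id, h.tendsto.congr' ?_⟩
  filter_upwards [hn₁.eventually_ge_atTop 1, hn₂.eventually_ge_atTop 1] with j h1 h2
  refine Subtype.ext ?_
  simp only
  congr 1
  ext ω
  have hn : 0 ≤ (n₁ j : ℝ) + n₂ j := by positivity
  rw [linearPart, mul_add, sqrt_mul_div_mul_sum _ h1 hn, sqrt_mul_div_mul_sum _ h2 hn,
    integral_limitX hX hr₁]
  simp only [influence, Sum.elim_inl, Sum.elim_inr]
  rcases Nat.eq_zero_or_pos r₂ with hr₂ | hr₂
  · subst hr₂
    simp
  · rw [integral_limitY hY hr₂]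

/-- Asymptotic normality of the estimator. -/
lemma tendstoInDistribution_estimator (hs : IndepSample μ Z (jointDensity pX pY) M)
    (hd : 1 ≤ d) (hr₁ : 1 ≤ r₁)
    (hn₁ : Tendsto n₁ atTop atTop) (hn₂ : Tendsto n₂ atTop atTop) (hp₀ : 0 < p) (hp₁ : p < 1)
    (hp : Tendsto (fun j => (n₁ j : ℝ) / ((n₁ j : ℝ) + (n₂ j : ℝ))) atTop (𝓝 p))
    (hε_pos : ∀ j, 0 < ε j) (hε : Tendsto ε atTop (𝓝 0))
    (h : Tendsto (fun j => ((n₁ j : ℝ) + n₂ j) * ε j ^ d) atTop atTop) :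
    TendstoInDistribution
      (fun j ω => √((n₁ j : ℝ) + n₂ j) *
        (estimator Z r₁ r₂ (n₁ j) (n₂ j) (ε j) ω - qTilde r₁ r₂ pX pY (ε j))) atTop
      (id : ℝ → ℝ) (fun _ => μ) (gaussianReal 0 (kappa r₁ r₂ pX pY p).toNNReal) := by
  have hE := fun j => ((memLp_estimator hs (hε_pos j) r₁ r₂ (n₁ j) (n₂ j)).sub
    (memLp_const (qTilde r₁ r₂ pX pY (ε j)))).const_mul √((n₁ j : ℝ) + n₂ j)
  have hL := fun j => (memLp_linearPart hs r₁ r₂ (n₁ j) (n₂ j)).const_mul √((n₁ j : ℝ) + n₂ j)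
  refine tendstoInDistribution_of_tendstoInMeasure_sub _ _
    (tendstoInDistribution_linearPart hs hr₁ hn₁ hn₂ hp₀ hp₁ hp) ?_
    fun j => (hE j).aestronglyMeasurable.aemeasurable
  refine tendstoInMeasure_of_integral_sq (fun j => (hE j).sub (hL j)) ?_
  refine (tendsto_mul_integral_sq_linearization (r₂ := r₂) hs hd hr₁ hn₁ hn₂ hp₀ hp₁ hp hε_pos
    hε h).congr fun j => ?_
  rw [← integral_const_mul]
  congr with ω
  have hn : 0 ≤ (n₁ j : ℝ) + n₂ j := by positivity
  simp only [Pi.sub_apply]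
  rw [← mul_sub, mul_pow, Real.sq_sqrt hn]

/-- Consistency of the estimator. -/
lemma tendstoInMeasure_estimator (hs : IndepSample μ Z (jointDensity pX pY) M)
    (hd : 1 ≤ d) (hr₁ : 1 ≤ r₁)
    (hn₁ : Tendsto n₁ atTop atTop) (hn₂ : Tendsto n₂ atTop atTop) (hp₀ : 0 < p) (hp₁ : p < 1)
    (hp : Tendsto (fun j => (n₁ j : ℝ) / ((n₁ j : ℝ) + (n₂ j : ℝ))) atTop (𝓝 p))
    (hε_pos : ∀ j, 0 < ε j) (hε : Tendsto ε atTop (𝓝 0))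
    (h : Tendsto (fun j => ((n₁ j : ℝ) + n₂ j) *
      ε j ^ ((d : ℝ) * (1 - 1 / ((r₁ : ℝ) + r₂)))) atTop atTop) :
    TendstoInMeasure μ (fun j => estimator Z r₁ r₂ (n₁ j) (n₂ j) (ε j)) atTop
      fun _ => q r₁ r₂ pX pY := by
  obtain ⟨K, hK⟩ := exists_integral_sq_estimator_sub_le_rate hs hd hr₁ hn₁ hn₂ hp₀ hp₁ hp hε_pos hε
    one_pos (h.eventually_ge_atTop 1)
  have hE := fun j => memLp_estimator hs (hε_pos j) r₁ r₂ (n₁ j) (n₂ j)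
  have hrate : Tendsto (fun j => K * (((n₁ j : ℝ) + n₂ j)⁻¹ *
      ε j ^ ((d : ℝ) * (1 / ((r₁ : ℝ) + r₂) - 1)))) atTop (𝓝 0) := by
    have h1 := (tendsto_inv_atTop_zero.comp h).const_mul K
    rw [mul_zero] at h1
    refine h1.congr fun j => ?_
    rw [Function.comp_apply, mul_inv, ← Real.rpow_neg (hε_pos j).le]
    congr 3
    ring
  have hsq : Tendsto (fun j => ∫ ω, (estimator Z r₁ r₂ (n₁ j) (n₂ j) (ε j) ω -
      qTilde r₁ r₂ pX pY (ε j)) ^ 2 ∂μ) atTop (𝓝 0) :=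
    squeeze_zero' (Eventually.of_forall fun j => integral_nonneg fun _ => sq_nonneg _) hK hrate
  -- the mean square error around `q` is at most twice the one around `q̃` plus twice the square
  -- of the bias
  have hsq' : Tendsto (fun j => ∫ ω, (estimator Z r₁ r₂ (n₁ j) (n₂ j) (ε j) ω -
      q r₁ r₂ pX pY) ^ 2 ∂μ) atTop (𝓝 0) := by
    have hbias := ((tendsto_qTilde (r₂ := r₂) hs.densityX hs.densityY hr₁ hε_pos hε).sub_const
      (q r₁ r₂ pX pY)).pow 2
    rw [sub_self, zero_pow two_ne_zero] at hbias
    have hsum := (hsq.const_mul 2).add (hbias.const_mul 2)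
    simp only [mul_zero, add_zero] at hsum
    refine squeeze_zero (fun j => integral_nonneg fun _ => sq_nonneg _) (fun j => ?_) hsum
    have i1 : Integrable (fun ω => (estimator Z r₁ r₂ (n₁ j) (n₂ j) (ε j) ω -
      q r₁ r₂ pX pY) ^ 2) μ := ((hE j).sub (memLp_const _)).integrable_sq
    have i2 : Integrable (fun ω => (estimator Z r₁ r₂ (n₁ j) (n₂ j) (ε j) ω -
      qTilde r₁ r₂ pX pY (ε j)) ^ 2) μ := ((hE j).sub (memLp_const _)).integrable_sq
    calc _ ≤ ∫ ω, (2 * (estimator Z r₁ r₂ (n₁ j) (n₂ j) (ε j) ω - qTilde r₁ r₂ pX pY (ε j)) ^ 2 +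
          2 * (qTilde r₁ r₂ pX pY (ε j) - q r₁ r₂ pX pY) ^ 2) ∂μ := by
          refine integral_mono i1 ((i2.const_mul 2).add (integrable_const _)) fun ω => ?_
          nlinarith [sq_nonneg ((estimator Z r₁ r₂ (n₁ j) (n₂ j) (ε j) ω -
            qTilde r₁ r₂ pX pY (ε j)) - (qTilde r₁ r₂ pX pY (ε j) - q r₁ r₂ pX pY))]
      _ = _ := by
          rw [integral_add (i2.const_mul 2) (integrable_const _), integral_const_mul]
          simp
  have hmeas := tendstoInMeasure_of_integral_sq (fun j => (hE j).sub (memLp_const (q r₁ r₂ pX pY)))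
    hsq'
  rw [tendstoInMeasure_iff_norm] at hmeas ⊢
  simpa using hmeas

end Normality

end RenyiStat

theorem theorem2 {Ω : Type*} [MeasurableSpace Ω] (μ : Measure Ω) [IsProbabilityMeasure μ]
    (d : ℕ) (hd : 1 ≤ d) (r₁ r₂ : ℕ) (hr₁ : 1 ≤ r₁)
    -- the densities: nonnegative, bounded, continuous off a finite set
    (pX pY : RenyiStat.Sp d → ℝ)
    (hpX_nonneg : ∀ x, 0 ≤ pX x) (hpY_nonneg : ∀ x, 0 ≤ pY x)
    (hpX_bdd : ∃ C, ∀ x, pX x ≤ C) (hpY_bdd : ∃ C, ∀ x, pY x ≤ C)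
    (hpX_cont : {x | ¬ ContinuousAt pX x}.Finite) (hpY_cont : {x | ¬ ContinuousAt pY x}.Finite)
    -- the two mutually independent i.i.d. samples
    (X Y : ℕ → Ω → RenyiStat.Sp d)
    (hX_meas : ∀ i, Measurable (X i)) (hY_meas : ∀ i, Measurable (Y i))
    (hX_law : ∀ i, μ.map (X i) = RenyiStat.law pX)
    (hY_law : ∀ i, μ.map (Y i) = RenyiStat.law pY)
    (h_indep : iIndepFun (Sum.elim X Y : ℕ ⊕ ℕ → Ω → RenyiStat.Sp d) μ)
    -- the sample sizes and the radii, along an arbitrary sequence with `n₁, n₂ → ∞`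
    (n₁ n₂ : ℕ → ℕ) (ε : ℕ → ℝ) (p : ℝ)
    (hn₁ : Tendsto n₁ atTop atTop) (hn₂ : Tendsto n₂ atTop atTop)
    (hp₀ : 0 < p) (hp₁ : p < 1)
    (hp : Tendsto (fun j => (n₁ j : ℝ) / ((n₁ j : ℝ) + (n₂ j : ℝ))) atTop (𝓝 p))
    (hε_pos : ∀ j, 0 < ε j) (hε : Tendsto ε atTop (𝓝 0)) :
    let n : ℕ → ℝ := fun j => (n₁ j : ℝ) + (n₂ j : ℝ)
    let r : ℝ := (r₁ : ℝ) + (r₂ : ℝ)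
    let Q : ℕ → Ω → ℝ := fun j ω =>
      RenyiStat.UTilde r₁ r₂ (n₁ j) (n₂ j) (ε j) (fun i => X i ω) (fun i => Y i ω)
    -- (i) variance bound, asymptotic unbiasedness, consistency
    (((∃ c : ℝ, 0 < c ∧ ∀ᶠ j in atTop, c ≤ n j * ε j ^ ((d : ℝ) * (1 - 1 / r))) →
        (fun j => Var[Q j; μ]) =O[atTop] fun j => (n j)⁻¹ * ε j ^ ((d : ℝ) * (1 / r - 1))) ∧
      Tendsto (fun j => ∫ ω, Q j ω ∂μ) atTop (𝓝 (RenyiStat.q r₁ r₂ pX pY)) ∧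
      (Tendsto (fun j => n j * ε j ^ ((d : ℝ) * (1 - 1 / r))) atTop atTop →
        TendstoInMeasure μ Q atTop fun _ => RenyiStat.q r₁ r₂ pX pY)) ∧
    -- (ii) asymptotic normality
    (Tendsto (fun j => n j * ε j ^ d) atTop atTop →
      0 < RenyiStat.zeta10 r₁ r₂ pX pY →
      (r₂ ≠ 0 → 0 < RenyiStat.zeta01 r₁ r₂ pX pY) →
      TendstoInDistribution
        (fun j ω => √(n j) * (Q j ω - RenyiStat.qTilde r₁ r₂ pX pY (ε j))) atTop
        (id : ℝ → ℝ) (fun _ => μ)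
        (gaussianReal 0 (RenyiStat.kappa r₁ r₂ pX pY p).toNNReal)) := by
  obtain ⟨CX, hCX⟩ := hpX_bdd
  obtain ⟨CY, hCY⟩ := hpY_bdd
  have hpX : RenyiStat.BoundedDensity pX (max CX CY) :=
    ⟨hpX_nonneg, fun x => (hCX x).trans (le_max_left _ _),
      RenyiStat.measurable_of_finite_discontinuities hpX_cont,
      hX_law 0 ▸ Measure.isProbabilityMeasure_map (hX_meas 0).aemeasurable,
      RenyiStat.ae_continuousAt hd hpX_cont⟩
  have hpY : RenyiStat.BoundedDensity pY (max CX CY) :=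
    ⟨hpY_nonneg, fun x => (hCY x).trans (le_max_right _ _),
      RenyiStat.measurable_of_finite_discontinuities hpY_cont,
      hY_law 0 ▸ Measure.isProbabilityMeasure_map (hY_meas 0).aemeasurable,
      RenyiStat.ae_continuousAt hd hpY_cont⟩
  have hs : RenyiStat.IndepSample μ (Sum.elim X Y) (RenyiStat.jointDensity pX pY) (max CX CY) :=
    ⟨h_indep, fun i => by rcases i with i | i; exacts [hX_meas i, hY_meas i],
      fun i => by rcases i with i | i; exacts [hX_law i, hY_law i],
      fun i => by rcases i with i | i; exacts [hpX, hpY]⟩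
  intro n r Q
  have hQ : Q = fun j => RenyiStat.estimator (Sum.elim X Y) r₁ r₂ (n₁ j) (n₂ j) (ε j) := rfl
  clear_value Q
  subst hQ
  -- the mean equals `q̃` once both samples are large enough
  have hmean : ∀ᶠ j in atTop,
      ∫ ω, RenyiStat.estimator (Sum.elim X Y) r₁ r₂ (n₁ j) (n₂ j) (ε j) ω ∂μ =
      RenyiStat.qTilde r₁ r₂ pX pY (ε j) := by
    filter_upwards [hn₁.eventually_ge_atTop r₁, hn₂.eventually_ge_atTop r₂] with j h1 h2
    exact RenyiStat.integral_estimator hs hr₁ (hε_pos j) h1 h2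
  refine ⟨⟨?_, ?_, ?_⟩, ?_⟩
  · rintro ⟨c, hc, h⟩
    obtain ⟨K, hK⟩ := RenyiStat.exists_integral_sq_estimator_sub_le_rate hs hd hr₁ hn₁ hn₂ hp₀ hp₁
      hp hε_pos hε hc h
    refine IsBigO.of_bound K ?_
    filter_upwards [hK, hmean] with j hj hmj
    have hn : 0 ≤ n j := by positivity
    have hεp : 0 < ε j ^ ((d : ℝ) * (1 / r - 1)) := Real.rpow_pos_of_pos (hε_pos j) _
    rw [Real.norm_of_nonneg (variance_nonneg _ _), Real.norm_of_nonneg (by positivity),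
      variance_eq_integral
        (RenyiStat.measurable_estimator hs (hε_pos j) r₁ r₂ (n₁ j) (n₂ j)).aemeasurable, hmj]
    exact hj
  · exact (RenyiStat.tendsto_qTilde hpX hpY hr₁ hε_pos hε).congr' (hmean.mono fun j hj => hj.symm)
  · exact RenyiStat.tendstoInMeasure_estimator hs hd hr₁ hn₁ hn₂ hp₀ hp₁ hp hε_pos hε
  · exact fun h _ _ =>
      RenyiStat.tendstoInDistribution_estimator hs hd hr₁ hn₁ hn₂ hp₀ hp₁ hp hε_pos hε h
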